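/- Let $J$ be a finite set, $L\colon J\times J\to\{A,N\}$ and $L_N\colon J\times J\to\mathbb{N}\cup\{\infty\}$ (with $0\in\mathbb N$). A finite simple graph $G$ *is encoded by* $(J,L,L_N)$ if there is a map $\phi\colon V(G)\to J$ such that for every $v\in V(G)$ and every $j\in J$ with $L_N(\phi(v),j)\neq\infty$: - if $L(\phi(v),j)=A$, then at most $L_N(\phi(v),j)$ vertices $v'\neq v$ with $\phi(v')=j$ are non-adjacent to $v$; - if $L(\phi(v),j)=N$, then at most $L_N(\phi(v),j)$ vertices $v'\neq v$ with $\phi(v')=j$ are adjacent to $v$. The triple $(J,L,L_N)$ is a *simple path encoding* if $L$ is symmetric, i.e. $L(j,j')=L(j',j)$ for all $j,j'\in J$, and there is a sequence $(p_1,\dots,p_t)$ of $t\geq 2$ pairwise distinct elements of $J$ such that $L_N(p_1,p_2)=\infty$, $L_N(p_t,p_{t-1})\geq 2$, and $L_N(p_k,p_{k+1})\geq 1$ and $L_N(p_{k+1},p_k)\geq 1$ for all $k\in\{1,\dots,t-1\}$. **Theorem.** For every simple path encoding $(J,L,L_N)$, the class $\mathcal C$ of finite graphs encoded by $(J,L,L_N)$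 is graph isomorphism complete. That is, the problem of deciding whether two given graphs from $\mathcal C$ are isomorphic (a promise problem: inputs are promised to lie in $\mathcal C$) and the problem of deciding whether two arbitrary given finite graphs are isomorphic are reducible to each other by polynomial-time many-one reductions. -/

import Mathlib

/-! ### Encodings and the graph classes they define -/

/-- The labels: `A` for adjacent and `N` for non-adjacent. -/
inductive AdjLabel : Type
  | A
  | N

/-- A triple `(J, L, L_N)`; the underlying finite set `J` is the type parameter. -/
structure GraphEncoding (J : Type*) where
  /-- whether an ordered pair is by default adjacent or non-adjacent -/
  L : J → J → AdjLabel
  /-- the number of exceptions allowed per vertex; `⊤` stands for infinity -/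
  LN : J → J → ℕ∞

namespace GraphEncoding

variable {J : Type*}

/-- The graph `G` belongs to the class encoded by `(J, L, L_N)`. -/
def Encodes (E : GraphEncoding J) {V : Type*} (G : SimpleGraph V) : Prop :=
  ∃ φ : V → J, ∀ (v : V) (j : J),
    (E.L (φ v) j = AdjLabel.A → E.LN (φ v) j ≠ ⊤ →
      {v' : V | v' ≠ v ∧ ¬ G.Adj v v' ∧ φ v' = j}.encard ≤ E.LN (φ v) j) ∧
    (E.L (φ v) j = AdjLabel.N → E.LN (φ v) j ≠ ⊤ →
      {v' : V | v' ≠ v ∧ G.Adj v v' ∧ φ v' = j}.encard ≤ E.LN (φ v) j)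

/-- `(J, L, L_N)` is a simple path encoding: `L` is symmetric and there is a path
`p 0, …, p (s + 1)` of `t = s + 2 ≥ 2` pairwise distinct elements of `J` with the stated
bounds on the numbers of exceptions. -/
def IsSimplePath (E : GraphEncoding J) : Prop :=
  (∀ j j' : J, E.L j j' = E.L j' j) ∧
  ∃ (s : ℕ) (p : Fin (s + 2) → J), Function.Injective p ∧
    E.LN (p 0) (p 1) = ⊤ ∧
    2 ≤ E.LN (p (Fin.last s).succ) (p (Fin.last s).castSucc) ∧
    ∀ k : Fin (s + 1),
      1 ≤ E.LN (p k.castSucc) (p k.succ) ∧ 1 ≤ E.LN (p k.succ) (p k.castSucc)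

end GraphEncoding

/-! ### Finite graphs as inputs of machines -/

/-- A finite simple graph, presented on the vertex set `{0, …, order - 1}`. -/
structure FinGraph where
  /-- the number of vertices -/
  order : ℕ
  /-- the graph itself -/
  graph : SimpleGraph (Fin order)

namespace FinGraph

open Classical in
/-- The word of a graph on `n` vertices: `n` in unary, closed by a `false`, and then the `n * n`
entries of the adjacency matrix, row by row. -/
noncomputable def encode (G : FinGraph) : List Bool :=
  List.replicate G.order true ++ false ::
    (List.finRange G.order).flatMap fun i =>
      (List.finRange G.order).map fun j => decide (G.graph.Adj i j)

/-- The word of a pair of graphs (the words of graphs are self-delimiting). -/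
noncomputable def encodePair (P : FinGraph × FinGraph) : List Bool :=
  P.1.encode ++ P.2.encode

theorem replicate_append_inj : ∀ (m n : ℕ) (l l' : List Bool),
    List.replicate m true ++ false :: l = List.replicate n true ++ false :: l' → m = n ∧ l = l'
  | 0, 0, _, _, h => by simpa using h
  | 0, n + 1, _, _, h => by simp [List.replicate_succ] at h
  | m + 1, 0, _, _, h => by simp [List.replicate_succ] at h
  | m + 1, n + 1, l, l', h => by
      have := replicate_append_inj m n l l' (by simpa [List.replicate_succ] using h)
      exact ⟨congrArg _ this.1, this.2⟩

theorem flatMap_append_inj {α β : Type} (f g : α → List β) (hfg : ∀ a, (f a).length = (g a).length)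
    (l l' : List β) : ∀ s : List α, s.flatMap f ++ l = s.flatMap g ++ l' →
      (∀ a ∈ s, f a = g a) ∧ l = l'
  | [], h => by simpa using h
  | a :: s, h => by
      simp only [List.flatMap_cons, List.append_assoc] at h
      obtain ⟨h1, h2⟩ := List.append_inj h (hfg a)
      obtain ⟨h3, h4⟩ := flatMap_append_inj f g hfg l l' s h2
      exact ⟨by simpa using ⟨h1, h3⟩, h4⟩

theorem encode_append_inj {G H : FinGraph} {l l' : List Bool}
    (h : G.encode ++ l = H.encode ++ l') : G = H ∧ l = l' := by
  obtain ⟨m, G⟩ := G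
  obtain ⟨n, H⟩ := H
  simp only [encode, List.append_assoc, List.cons_append] at h
  obtain ⟨rfl, h⟩ := replicate_append_inj _ _ _ _ h
  obtain ⟨h1, h2⟩ := flatMap_append_inj _ _ (fun a => by simp) _ _ _ h
  refine ⟨?_, h2⟩
  congr 1
  ext i j
  have := h1 i (List.mem_finRange i)
  simpa using List.map_inj_left.1 this j (List.mem_finRange j)

/-- Distinct pairs of graphs have distinct words. -/
theorem encodePair_injective : Function.Injective encodePair := by
  rintro ⟨G₁, G₂⟩ ⟨H₁, H₂⟩ h
  obtain ⟨rfl, h⟩ := encode_append_inj h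
  have h' : G₂.encode ++ [] = H₂.encode ++ [] := by simpa [encodePair] using h
  rw [(encode_append_inj h').1]

end FinGraph

/-! ### Graph isomorphism completeness -/

/-- A promise problem about pairs of finite graphs: its instances are the pairs in `yes` and the
pairs in `no`. -/
structure GraphPairProblem where
  /-- the instances to be accepted -/
  yes : Set (FinGraph × FinGraph)
  /-- the instances to be rejected -/
  no : Set (FinGraph × FinGraph)
  /-- no instance is both -/
  disjoint : Disjoint yes no

/-- Polynomial-time many-one reducibility of promise problems: some function, computed by a
(multi-stack) Turing machine in polynomially many steps in the length of its input, maps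
yes-instances to yes-instances and no-instances to no-instances. -/
def GraphPairProblem.PolyTimeReducible (P Q : GraphPairProblem) : Prop :=
  ∃ f : FinGraph × FinGraph → FinGraph × FinGraph,
    Nonempty (Turing.TM2ComputableInPolyTime FinGraph.encodePair FinGraph.encodePair f) ∧
    (∀ x ∈ P.yes, f x ∈ Q.yes) ∧ (∀ x ∈ P.no, f x ∈ Q.no)

/-- The isomorphism problem on a graph class `C`: given two graphs from `C`, decide whether they
are isomorphic. -/
def isoProblem (C : Set FinGraph) : GraphPairProblem where
  yes := {x | x.1 ∈ C ∧ x.2 ∈ C ∧ Nonempty (x.1.graph ≃g x.2.graph)}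
  no := {x | x.1 ∈ C ∧ x.2 ∈ C ∧ ¬ Nonempty (x.1.graph ≃g x.2.graph)}
  disjoint := Set.disjoint_left.2 fun _ h h' => h'.2.2 h.2.2

/-- A graph class is graph isomorphism complete if its isomorphism problem and the isomorphism
problem on all finite graphs are polynomial-time reducible to each other. -/
def IsGraphIsomorphismComplete (C : Set FinGraph) : Prop :=
  (isoProblem C).PolyTimeReducible (isoProblem Set.univ) ∧
  (isoProblem Set.univ).PolyTimeReducible (isoProblem C)

/-- The class of finite graphs encoded by `(J, L, L_N)`. -/
def GraphEncoding.encodedClass {J : Type*} (E : GraphEncoding J) : Set FinGraph :=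
  {G | E.Encodes G.graph}

/-!
The isomorphism problem on a class reduces to the problem on all graphs by the identity. For the
other direction, fix the path `p 0, …, p (s + 1)` of a simple path encoding; its elements are
called classes here.

*The reduction.* From a graph `A` build a sparse graph (`ChainGraph.chainGraph`): each vertex gets
a hub in class `0`, and each ordered pair `(i, j)` gets three chains of vertices, of classes
`1, …, s, s + 1, s, …, 1`, starting at the hub of `i`. Exactly if `i` and `j` are adjacent, these
chains also end at the hub of `j`. Isolated vertices are added to each class. Then complement the
adjacency between any two classes with label `A` (`SimpleGraph.twist`). The links of the sparse
graph are the exceptions in the sense of the encoding: a hub may have arbitrarily many, all in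
class `1`, the middle of a chain has two in the class before the last one, and all others are
matchings between consecutive classes (`ChainGraph.encodes_twist`).

*Recovering the graph.* In the twisted graph, the neighborhoods of two vertices whose classes have
the same labels differ only by few exceptions, while otherwise they differ in almost a whole class
(`SimpleGraph.twist_similar_iff`). The classes are so large that an isomorphism has to respect this
relation, and their sizes are distinct powers of two times a common number, so that it has to fix the
sets of classes with equal labels. Hence it preserves labels and therefore the sparse graph
(`SimpleGraph.adj_iff_of_twist_iso`). There the hubs are the vertices of degree at least three, and
two of them belong to adjacent vertices if and only if they are joined by a chain
(`ChainGraph.nonempty_iso_of_chainGraph_iso`).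

*Polynomial time.* The vertices of the twisted graph are triples of a kind, from a finite set that
depends on `s` only, and two vertices of `A`. An entry of its adjacency matrix depends only on the
two kinds, on some equalities between the four vertices, and on two entries of the matrix of `A`.
A program in a small structured language (`StackProg`) outputs all entries by nested loops
(`GraphMem.exec_ruleProg`), and such programs are compiled to stack Turing machines whose labels
are the finitely many possible continuations (`StackProg.polyTime_of_runs`).
-/

/-! ### A structured language for stack machines -/

/-- Structured programs acting on finitely many stacks of bits, indexed by `K`. The tests of
`ite` and `loop` look at the top symbol of a stack, which is `none` if the stack is empty. -/
inductive StackProg (K : Type) : Type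
  /-- push a bit to a stack -/
  | push : K → Bool → StackProg K
  /-- remove the top of a stack, if there is one -/
  | pop : K → StackProg K
  /-- run the first program if the top of the stack passes the test, and the second otherwise -/
  | ite : K → (Option Bool → Bool) → StackProg K → StackProg K → StackProg K
  /-- run the program as long as the top of the stack passes the test -/
  | loop : K → (Option Bool → Bool) → StackProg K → StackProg K
  /-- do nothing -/
  | skip : StackProg K
  /-- run one program after the other -/
  | seq : StackProg K → StackProg K → StackProg K

namespace StackProg

variable {K : Type}

/-- Sequential composition of programs. -/
infixr:65 " ;; " => StackProg.seq

section Semantics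

variable [DecidableEq K]

/-- One step of execution. A configuration consists of the list of programs still to be run and
of the contents of the stacks. -/
def step : List (StackProg K) × (K → List Bool) → List (StackProg K) × (K → List Bool)
  | ([], S) => ([], S)
  | (push k b :: c, S) => (c, Function.update S k (b :: S k))
  | (pop k :: c, S) => (c, Function.update S k (S k).tail)
  | (ite k t P Q :: c, S) => (cond (t (S k).head?) (P :: c) (Q :: c), S)
  | (loop k t P :: c, S) => (cond (t (S k).head?) (P :: loop k t P :: c) c, S)
  | (skip :: c, S) => (c, S)
  | (seq P Q :: c, S) => (P :: Q :: c, S)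

/-- Started with the stacks `S`, the program `P` stops within `t` steps, with the stacks `S'`. -/
def Runs (P : StackProg K) (S S' : K → List Bool) (t : ℕ) : Prop :=
  ∀ c, ∃ n ≤ t, step^[n] (P :: c, S) = (c, S')

theorem Runs.mono {P : StackProg K} {S S' : K → List Bool} {t t' : ℕ} (h : Runs P S S' t)
    (ht : t ≤ t') : Runs P S S' t' := fun c =>
  let ⟨n, hn, e⟩ := h c
  ⟨n, hn.trans ht, e⟩

theorem Runs.congr_right {P : StackProg K} {S S' S'' : K → List Bool} {t : ℕ}
    (h : Runs P S S' t) (e : S' = S'') : Runs P S S'' t := e ▸ h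

theorem Runs.push (k : K) (b : Bool) (S : K → List Bool) :
    Runs (push k b) S (Function.update S k (b :: S k)) 1 := fun _ => ⟨1, le_rfl, rfl⟩

theorem Runs.pop (k : K) (S : K → List Bool) :
    Runs (pop k) S (Function.update S k (S k).tail) 1 := fun _ => ⟨1, le_rfl, rfl⟩

theorem Runs.skip (S : K → List Bool) : Runs skip S S 1 := fun _ => ⟨1, le_rfl, rfl⟩

theorem Runs.seq {P Q : StackProg K} {S S' S'' : K → List Bool} {t t' : ℕ} (h : Runs P S S' t)
    (h' : Runs Q S' S'' t') : Runs (P ;; Q) S S'' (t + t' + 1) := fun c => by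
  obtain ⟨n, hn, e⟩ := h (Q :: c)
  obtain ⟨n', hn', e'⟩ := h' c
  refine ⟨n' + n + 1, by omega, ?_⟩
  rw [Function.iterate_succ_apply, step, Function.iterate_add_apply, e, e']

theorem Runs.ite {k : K} {u : Option Bool → Bool} {P Q : StackProg K} {S S' : K → List Bool}
    {t : ℕ} (h : Runs (cond (u (S k).head?) P Q) S S' t) : Runs (ite k u P Q) S S' (t + 1) :=
  fun c => by
    obtain ⟨n, hn, e⟩ := h c
    refine ⟨n + 1, by omega, ?_⟩
    rw [Function.iterate_succ_apply, step, ← e]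
    cases u (S k).head? <;> rfl

theorem Runs.loop_done {k : K} {u : Option Bool → Bool} {P : StackProg K} {S : K → List Bool}
    (h : u (S k).head? = false) : Runs (loop k u P) S S 1 :=
  fun c => ⟨1, le_rfl, by simp [step, h]⟩

theorem Runs.loop_step {k : K} {u : Option Bool → Bool} {P : StackProg K}
    {S S' S'' : K → List Bool} {t t' : ℕ} (h : u (S k).head? = true) (hP : Runs P S S' t)
    (hL : Runs (loop k u P) S' S'' t') : Runs (loop k u P) S S'' (t + t' + 1) := fun c => by
  obtain ⟨n, hn, e⟩ := hP (StackProg.loop k u P :: c)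
  obtain ⟨n', hn', e'⟩ := hL c
  refine ⟨n' + n + 1, by omega, ?_⟩
  rw [Function.iterate_succ_apply, step, h, cond_true, Function.iterate_add_apply, e, e']

/-- A loop that runs through the states `F 0, …, F n`. -/
theorem Runs.loop {k : K} {u : Option Bool → Bool} {P : StackProg K} {t : ℕ} :
    ∀ (n : ℕ) (F : ℕ → K → List Bool), (∀ x < n, u (F x k).head? = true) →
      (∀ x < n, Runs P (F x) (F (x + 1)) t) → u (F n k).head? = false →
      Runs (loop k u P) (F 0) (F n) (n * (t + 1) + 1)
  | 0, F, _, _, h => (Runs.loop_done h).mono (by omega)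
  | n + 1, F, hu, hP, h =>
    (Runs.loop_step (hu 0 (by omega)) (hP 0 (by omega))
      (Runs.loop n (fun x => F (x + 1)) (fun x hx => hu (x + 1) (by omega))
        (fun x hx => hP (x + 1) (by omega)) h)).mono (by ring_nf; omega)

end Semantics

/-! ### Compilation to stack Turing machines -/

/-- The lists of programs still to be run that can occur from the start of `P` up to its end,
where `c` is what remains to be run after `P`; the list `c` itself is left out. -/
def continuations : StackProg K → List (StackProg K) → Set (List (StackProg K))
  | ite k t P Q, c => {ite k t P Q :: c} ∪ (continuations P c ∪ continuations Q c)
  | loop k t P, c => {loop k t P :: c} ∪ continuations P (loop k t P :: c)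
  | seq P Q, c => {seq P Q :: c} ∪ (continuations P (Q :: c) ∪ continuations Q c)
  | push k b, c => {push k b :: c}
  | pop k, c => {pop k :: c}
  | skip, c => {skip :: c}

theorem finite_continuations (P : StackProg K) : ∀ c, (continuations P c).Finite := by
  induction P with
  | ite k t P Q hP hQ => exact fun c => (Set.finite_singleton _).union ((hP _).union (hQ _))
  | loop k t P hP => exact fun c => (Set.finite_singleton _).union (hP _)
  | seq P Q hP hQ => exact fun c => (Set.finite_singleton _).union ((hP _).union (hQ _))
  | _ => exact fun c => Set.finite_singleton _

theorem self_mem_continuations (P : StackProg K) (c : List (StackProg K)) :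
    P :: c ∈ continuations P c := by
  cases P <;> simp [continuations]

theorem step_mem_continuations [DecidableEq K] (P : StackProg K) :
    ∀ c, ∀ l ∈ continuations P c, ∀ S : K → List Bool,
      (step (l, S)).1 ∈ insert c (continuations P c) := by
  induction P with
  | ite k t P Q hP hQ =>
    rintro c l (rfl | hl | hl) S
    · have := self_mem_continuations P c
      have := self_mem_continuations Q c
      rw [step]
      cases t (S k).head? <;> simp_all [continuations]
    · rcases hP c l hl S with h | h
      · exact Or.inl h
      · exact Or.inr (Or.inr (Or.inl h))
    · rcases hQ c l hl S with h | h
      · exact Or.inl h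
      · exact Or.inr (Or.inr (Or.inr h))
  | loop k t P hP =>
    rintro c l (rfl | hl) S
    · have := self_mem_continuations P (StackProg.loop k t P :: c)
      rw [step]
      cases t (S k).head? <;> simp_all [continuations]
    · rcases hP _ l hl S with h | h
      · exact Or.inr (Or.inl h)
      · exact Or.inr (Or.inr h)
  | seq P Q hP hQ =>
    rintro c l (rfl | hl | hl) S
    · exact Or.inr (Or.inr (Or.inl (self_mem_continuations P _)))
    · rcases hP _ l hl S with h | h
      · have h' := self_mem_continuations Q c
        rw [← h] at h'
        exact Or.inr (Or.inr (Or.inr h'))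
      · exact Or.inr (Or.inr (Or.inl h))
    · rcases hQ c l hl S with h | h
      · exact Or.inl h
      · exact Or.inr (Or.inr (Or.inr h))
  | push k b => rintro c l rfl S; exact Or.inl rfl
  | pop k => rintro c l rfl S; exact Or.inl rfl
  | skip => rintro c l rfl S; exact Or.inl rfl

/-- The labels of the machine of `P`: the lists of programs that can remain to be run. -/
abbrev Label (P : StackProg K) : Type := {c // c ∈ insert [] (continuations P [])}

noncomputable instance (P : StackProg K) : Fintype (Label P) :=
  ((finite_continuations P []).insert []).fintype

open Classical in
/-- A list of programs as a label; the value is irrelevant for lists that cannot occur. -/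
noncomputable def toLabel (P : StackProg K) (c : List (StackProg K)) : Label P :=
  if h : c ∈ insert [] (continuations P []) then ⟨c, h⟩ else ⟨[], Or.inl rfl⟩

theorem toLabel_val {P : StackProg K} {c : List (StackProg K)}
    (h : c ∈ insert [] (continuations P [])) : (toLabel P c).1 = c := by
  rw [toLabel, dif_pos h]

open Turing.TM2.Stmt in
/-- The statement executing one step. The internal state of the machine holds a top symbol while
a test is made and is `none` between two steps. -/
noncomputable def stmt (P : StackProg K) :
    List (StackProg K) → Turing.TM2.Stmt (fun _ : K => Bool) (Label P) (Option Bool)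
  | [] => .halt
  | .push k b :: c => .push k (fun _ => b) (goto fun _ => toLabel P c)
  | .pop k :: c => .pop k (fun v _ => v) (goto fun _ => toLabel P c)
  | .ite k t P₁ P₂ :: c => peek k (fun _ o => o) (branch t
      (load (fun _ => none) (goto fun _ => toLabel P (P₁ :: c)))
      (load (fun _ => none) (goto fun _ => toLabel P (P₂ :: c))))
  | .loop k t P₁ :: c => peek k (fun _ o => o) (branch t
      (load (fun _ => none) (goto fun _ => toLabel P (P₁ :: .loop k t P₁ :: c)))
      (load (fun _ => none) (goto fun _ => toLabel P c)))
  | .skip :: c => goto fun _ => toLabel P c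
  | .seq P₁ P₂ :: c => goto fun _ => toLabel P (P₁ :: P₂ :: c)

/-- The Turing machine of a program, with input stack `i` and output stack `o`. -/
noncomputable def machine [DecidableEq K] [Fintype K] (P : StackProg K) (i o : K) :
    Turing.FinTM2 where
  K := K
  k₀ := i
  k₁ := o
  Γ _ := Bool
  Λ := Label P
  main := toLabel P [P]
  σ := Option Bool
  initialState := none
  Γk₀Fin := inferInstanceAs (Fintype Bool)
  m l := stmt P l.1

section Simulation

variable [DecidableEq K] [Fintype K]

/-- The configuration of the machine of `P` that corresponds to a configuration of `P`. -/
noncomputable def toCfg (P : StackProg K) (i o : K)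
    (x : List (StackProg K) × (K → List Bool)) : (machine P i o).Cfg :=
  ⟨some (toLabel P x.1), none, x.2⟩

theorem machine_step (P : StackProg K) (i o : K) {c : List (StackProg K)}
    (hc : c ∈ continuations P []) (S : K → List Bool) :
    (machine P i o).step (toCfg P i o (c, S)) = some (toCfg P i o (step (c, S))) := by
  have hl : (toLabel P c).1 = c := toLabel_val (Or.inr hc)
  have hne : c ≠ [] := by
    rintro rfl
    have : ∀ (P : StackProg K) (d : List (StackProg K)), ∀ l ∈ continuations P d, l ≠ [] := by
      intro P
      induction P with
      | ite k t P Q hP hQ =>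
        rintro d l (rfl | hl | hl)
        exacts [by simp, hP _ _ hl, hQ _ _ hl]
      | loop k t P hP =>
        rintro d l (rfl | hl)
        exacts [by simp, hP _ _ hl]
      | seq P Q hP hQ =>
        rintro d l (rfl | hl | hl)
        exacts [by simp, hP _ _ hl, hQ _ _ hl]
      | _ => rintro d l rfl; simp
    exact this _ _ _ hc rfl
  have e : (machine P i o).step (toCfg P i o (c, S)) =
      some (Turing.TM2.stepAux (stmt P (toLabel P c).1) none S) := rfl
  rw [e, hl]
  match c, hne with
  | .push k b :: c, _ => rfl
  | .pop k :: c, _ => rfl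
  | .ite k t P₁ P₂ :: c, _ =>
    simp only [stmt, Turing.TM2.stepAux, step]
    cases t (S k).head? <;> rfl
  | .loop k t P₁ :: c, _ =>
    simp only [stmt, Turing.TM2.stepAux, step]
    cases t (S k).head? <;> rfl
  | .skip :: c, _ => rfl
  | .seq P₁ P₂ :: c, _ => rfl

theorem machine_evals (P : StackProg K) (i o : K) (S S' : K → List Bool) :
    ∀ (n : ℕ) (c : List (StackProg K)), c ∈ insert [] (continuations P []) →
      step^[n] (c, S) = ([], S') → ∃ m ≤ n + 1,
        (flip bind (machine P i o).step)^[m] (some (toCfg P i o (c, S))) =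
          some ⟨none, none, S'⟩ := by
  intro n
  induction n generalizing S with
  | zero =>
    rintro c - h
    obtain ⟨rfl, rfl⟩ : c = [] ∧ S = S' := by simpa using h
    refine ⟨1, le_rfl, ?_⟩
    have hl : (toLabel P []).1 = [] := toLabel_val (Or.inl rfl)
    have e : (flip bind (machine P i o).step)^[1] (some (toCfg P i o ([], S))) =
      some (Turing.TM2.stepAux (stmt P (toLabel P []).1) none S) := rfl
    rw [e, hl]
    rfl
  | succ n ih =>
    rintro c (rfl | hc) h
    · obtain ⟨m, hm, e⟩ := ih S [] (Or.inl rfl) (by rwa [Function.iterate_succ_apply] at h)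
      exact ⟨m, by omega, e⟩
    · rw [Function.iterate_succ_apply] at h
      obtain ⟨m, hm, e⟩ := ih (step (c, S)).2 (step (c, S)).1
        (step_mem_continuations P [] c hc S) h
      refine ⟨m + 1, by omega, ?_⟩
      rw [Function.iterate_succ_apply]
      have : flip bind (machine P i o).step (some (toCfg P i o (c, S))) =
        (machine P i o).step (toCfg P i o (c, S)) := rfl
      rw [this, machine_step P i o hc S, ← e]

theorem initList_machine (P : StackProg K) (i o : K) (w : List Bool) :
    Turing.initList (machine P i o) w =
      toCfg P i o ([P], Function.update (fun _ => []) i w) := by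
  have key (k : K) : (Turing.initList (machine P i o) w).stk k =
      Function.update (fun _ => ([] : List Bool)) i w k := by
    rcases eq_or_ne k i with rfl | h
    · rw [Function.update_self]
      exact dif_pos rfl
    · rw [Function.update_of_ne h]
      exact dif_neg h
  exact congrArg (Turing.TM2.Cfg.mk (some (toLabel P [P]) : Option (Label P)) (none : Option Bool))
    (funext key)

theorem haltList_machine (P : StackProg K) (i o : K) (w : List Bool) :
    Turing.haltList (machine P i o) w =
      ⟨none, none, Function.update (fun _ => []) o w⟩ := by
  have key (k : K) : (Turing.haltList (machine P i o) w).stk k =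
      Function.update (fun _ => ([] : List Bool)) o w k := by
    rcases eq_or_ne k o with rfl | h
    · rw [Function.update_self]
      exact dif_pos rfl
    · rw [Function.update_of_ne h]
      exact dif_neg h
  exact congrArg (Turing.TM2.Cfg.mk (none : Option (Label P)) (none : Option Bool))
    (funext key)

/-- A function between words is computed in polynomial time as soon as some program turns the
stacks holding just the input into the stacks holding just the output in polynomially many
steps. -/
theorem polyTime_of_runs {α β : Type} {ea : α → List Bool} {eb : β → List Bool} {f : α → β}
    (P : StackProg K) (i o : K) (p : Polynomial ℕ)
    (h : ∀ a, Runs P (Function.update (fun _ => []) i (ea a))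
      (Function.update (fun _ => []) o (eb (f a))) (p.eval (ea a).length)) :
    Nonempty (Turing.TM2ComputableInPolyTime ea eb f) := by
  have key : ∀ a, ∃ m ≤ (p + 1).eval (ea a).length,
      (flip bind (machine P i o).step)^[m] (some (Turing.initList (machine P i o) (ea a))) =
        some (Turing.haltList (machine P i o) (eb (f a))) := by
    intro a
    obtain ⟨n, hn, e⟩ := h a []
    obtain ⟨m, hm, e'⟩ := machine_evals P i o _ _ n [P] (Or.inr (self_mem_continuations P [])) e
    refine ⟨m, by simpa using hm.trans (Nat.succ_le_succ hn), ?_⟩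
    rw [initList_machine, haltList_machine]
    exact e'
  choose m hm e using key
  exact ⟨{
    tm := machine P i o
    inputAlphabet := Equiv.refl Bool
    outputAlphabet := Equiv.refl Bool
    time := p + 1
    outputsFun := fun a =>
      { steps := m a
        evals_in_steps := by
          let Q (x y : List Bool) : Prop := (flip bind (machine P i o).step)^[m a]
            (some (Turing.initList (machine P i o) x)) = some (Turing.haltList (machine P i o) y)
          exact (congrArg₂ Q (List.map_id (ea a)) (List.map_id (eb (f a)))).mpr (e a)
        steps_le_m := hm a } }⟩

end Simulation

end StackProg

/-! ### Elementary programs -/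

namespace StackProg

variable {K : Type}

/-- Run the programs of a list one after the other. -/
def concat : List (StackProg K) → StackProg K
  | [] => skip
  | P :: l => P ;; concat l

/-- Branch on the bit at the top of the stack `k`. -/
def branchTop (k : K) (F : Bool → StackProg K) : StackProg K :=
  ite k (· == some true) (F true) (F false)

/-- Move the top of the stack `a` to the stack `b`. -/
def move (a b : K) : StackProg K :=
  branchTop a (fun x => push b x) ;; pop a

/-- Move all symbols of the stack `a` to the stack `b`. -/
def moveAll (a b : K) : StackProg K :=
  loop a Option.isSome (move a b)

/-- Empty the stack `a`. -/
def clear (a : K) : StackProg K :=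
  loop a Option.isSome (pop a)

/-- Push to `flag` whether the stacks `x` and `y`, which hold numbers in unary, are equal. On the
auxiliary stack `tmp` is recorded for each symbol of `x` whether `y` has a matching symbol. -/
def compare (x y tmp flag : K) : StackProg K :=
  loop x Option.isSome
    (pop x ;; ite y Option.isSome (pop y ;; push tmp true) (push tmp false)) ;;
  ite y Option.isSome (push flag false)
    (ite tmp (· == some false) (push flag false) (push flag true)) ;;
  loop tmp Option.isSome
    (ite tmp (· == some true) (push y true) skip ;; pop tmp ;; push x true)

variable [DecidableEq K]

theorem Runs.branchTop {k : K} {F : Bool → StackProg K} {S S' : K → List Bool} {t : ℕ} {b : Bool}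
    (hb : (S k).head? = some b) (h : Runs (F b) S S' t) : Runs (branchTop k F) S S' (t + 1) :=
  Runs.ite (by cases b <;> simpa [hb] using h)

theorem Runs.move {a b : K} (hab : a ≠ b) {S : K → List Bool} {x : Bool} {l : List Bool}
    (h : S a = x :: l) :
    Runs (move a b) S (Function.update (Function.update S b (x :: S b)) a l) 4 := by
  have := (Runs.branchTop (k := a) (F := fun x => StackProg.push b x) (b := x) (by simp [h])
    (Runs.push b x S)).seq (Runs.pop a _)
  rw [Function.update_of_ne hab, h] at this
  exact this

theorem Runs.moveAll {a b : K} (hab : a ≠ b) {S : K → List Bool} {l : List Bool} (h : S a = l) :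
    Runs (moveAll a b) S (Function.update (Function.update S b (l.reverse ++ S b)) a [])
      (l.length * 5 + 1) := by
  induction l generalizing S with
  | nil =>
    have e : Function.update (Function.update S b ([].reverse ++ S b)) a [] = S := by
      funext k
      rcases eq_or_ne k a with rfl | hk
      · simp [h]
      · simp [hk]
    rw [e]
    exact (Runs.loop_done (by simp [h])).mono (by omega)
  | cons x l ih =>
    have := Runs.loop_step (u := Option.isSome) (by simp [h]) (Runs.move hab h)
      (ih (S := Function.update (Function.update S b (x :: S b)) a l) (by simp))
    have e : Function.update (Function.update S b ((x :: l).reverse ++ S b)) a [] =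
        Function.update (Function.update (Function.update (Function.update S b (x :: S b)) a l) b
          (l.reverse ++ Function.update (Function.update S b (x :: S b)) a l b)) a [] := by
      funext k
      by_cases hk : k = a <;> by_cases hk' : k = b <;> simp_all [Function.update_apply]
    rw [e]
    exact this.mono (by simp; omega)

theorem Runs.clear (a : K) {S : K → List Bool} {l : List Bool} (h : S a = l) :
    Runs (clear a) S (Function.update S a []) (l.length * 2 + 1) := by
  induction l generalizing S with
  | nil =>
    have e : Function.update S a [] = S := by rw [← h]; simp
    rw [e]
    exact (Runs.loop_done (by simp [h])).mono (by omega)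
  | cons x l ih =>
    have := Runs.loop_step (u := Option.isSome) (by simp [h]) (Runs.pop a S)
      (ih (S := Function.update S a (S a).tail) (by simp [h]))
    simp only [Function.update_idem] at this
    exact this.mono (by simp; omega)

theorem Runs.concat {ι : Type} (P : ι → StackProg K) (F : List ι → K → List Bool) {t : ℕ} :
    ∀ l l' : List ι, (∀ i l₁ l₂, l = l₁ ++ i :: l₂ →
      Runs (P i) (F (l' ++ l₁)) (F (l' ++ l₁ ++ [i])) t) →
      Runs (concat (l.map P)) (F l') (F (l' ++ l)) (l.length * (t + 1) + 1)
  | [], l', _ => by simpa using! (Runs.skip (F l')).mono (by omega)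
  | i :: l, l', h => by
    have h₁ := h i [] l rfl
    have h₂ := Runs.concat P F l (l' ++ [i]) (fun j l₁ l₂ e => by
      simpa using h j (i :: l₁) l₂ (by simp [e]))
    simp only [List.append_nil] at h₁
    have := h₁.seq h₂
    simp only [List.append_assoc, List.singleton_append] at this
    exact this.mono (by simp; ring_nf; omega)

theorem Runs.compare {x y tmp flag : K} (hxy : x ≠ y) (hxt : x ≠ tmp) (hxf : x ≠ flag)
    (hyt : y ≠ tmp) (hyf : y ≠ flag) (htf : tmp ≠ flag) {S : K → List Bool} {a b : ℕ}
    (hx : S x = List.replicate a true) (hy : S y = List.replicate b true) (ht : S tmp = []) :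
    Runs (compare x y tmp flag) S (Function.update S flag (decide (a = b) :: S flag))
      (a * 14 + 8) := by
  -- The stacks, as a function of the contents of the four stacks in use.
  let G (f t q p : List Bool) : K → List Bool :=
    Function.update (Function.update (Function.update (Function.update S flag f) tmp t) y q) x p
  have ex (f t q p) : G f t q p x = p := by simp [G]
  have ey (f t q p) : G f t q p y = q := by simp [G, hxy.symm]
  have et (f t q p) : G f t q p tmp = t := by simp [G, hxt.symm, hyt.symm]
  have ef (f t q p) : G f t q p flag = f := by simp [G, hxf.symm, hyf.symm, htf.symm]
  have ux (f t q p p') : Function.update (G f t q p) x p' = G f t q p' := by simp [G]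
  have uy (f t q p q') : Function.update (G f t q p) y q' = G f t q' p := by
    simp only [G]
    rw [Function.update_comm hxy, Function.update_idem]
  have ut (f t q p t') : Function.update (G f t q p) tmp t' = G f t' q p := by
    simp only [G]
    rw [Function.update_comm hxt, Function.update_comm hyt, Function.update_idem]
  have uf (f t q p f') : Function.update (G f t q p) flag f' = G f' t q p := by
    simp only [G]
    rw [Function.update_comm hxf, Function.update_comm hyf, Function.update_comm htf,
      Function.update_idem]
  have popX (f t q p) : Runs (.pop x) (G f t q p) (G f t q p.tail) 1 := by
    simpa only [ex, ux] using Runs.pop x (G f t q p)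
  have popY (f t q p) : Runs (.pop y) (G f t q p) (G f t q.tail p) 1 := by
    simpa only [ey, uy] using Runs.pop y (G f t q p)
  have popT (f t q p) : Runs (.pop tmp) (G f t q p) (G f t.tail q p) 1 := by
    simpa only [et, ut] using Runs.pop tmp (G f t q p)
  have pushX (c f t q p) : Runs (.push x c) (G f t q p) (G f t q (c :: p)) 1 := by
    simpa only [ex, ux] using Runs.push x c (G f t q p)
  have pushY (c f t q p) : Runs (.push y c) (G f t q p) (G f t (c :: q) p) 1 := by
    simpa only [ey, uy] using Runs.push y c (G f t q p)
  have pushT (c f t q p) : Runs (.push tmp c) (G f t q p) (G f (c :: t) q p) 1 := by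
    simpa only [et, ut] using Runs.push tmp c (G f t q p)
  have pushF (c f t q p) : Runs (.push flag c) (G f t q p) (G (c :: f) t q p) 1 := by
    simpa only [ef, uf] using Runs.push flag c (G f t q p)
  -- The stacks after `i` symbols of `x` have been treated, with `f` on the stack `flag`.
  let F (f : List Bool) (i : ℕ) : K → List Bool :=
    G f (List.replicate (i - b) false ++ List.replicate (min i b) true)
      (List.replicate (b - i) true) (List.replicate (a - i) true)
  have hF0 (f : List Bool) : F f 0 = Function.update S flag f := by
    funext k
    simp only [F, G, Function.update_apply]
    split_ifs <;> simp_all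
  have h₁ := Runs.loop (k := x) (u := Option.isSome) (t := 6)
    (P := .pop x ;; .ite y Option.isSome (.pop y ;; .push tmp true) (.push tmp false)) a (F (S flag))
    (fun i hi => by
      obtain ⟨d, hd⟩ : ∃ d, a - i = d + 1 := ⟨a - i - 1, by omega⟩
      simp [F, ex, hd, List.replicate_succ])
    (fun i hi => by
      obtain ⟨d, hd⟩ : ∃ d, a - i = d + 1 := ⟨a - i - 1, by omega⟩
      have hd' : a - (i + 1) = d := by omega
      refine ((popX _ _ _ _).seq (Runs.ite (t := 3) ?_)).mono le_rfl
      rw [ey]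
      rcases lt_or_ge i b with hb | hb
      · obtain ⟨e, he⟩ : ∃ e, b - i = e + 1 := ⟨b - i - 1, by omega⟩
        have := (popY (S flag) (List.replicate (i - b) false ++ List.replicate (min i b) true)
          (List.replicate (b - i) true) (List.replicate (a - i) true).tail).seq (pushT true _ _ _ _)
        simpa [F, hd, hd', he, show b - (i + 1) = e by omega, show i - b = 0 by omega,
          show i + 1 - b = 0 by omega, show min i b = i by omega,
          show min (i + 1) b = i + 1 by omega, List.replicate_succ] using this
      · have := pushT false (S flag) (List.replicate (i - b) false ++ List.replicate (min i b) true)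
          (List.replicate (b - i) true) (List.replicate (a - i) true).tail
        simpa [F, hd, hd', show b - i = 0 by omega, show b - (i + 1) = 0 by omega,
          show i + 1 - b = i - b + 1 by omega, show min i b = b by omega,
          show min (i + 1) b = b by omega, List.replicate_succ] using this.mono (t' := 3) (by omega))
    (by simp [F, ex])
  have h₂ : Runs (.ite y Option.isSome (.push flag false)
      (.ite tmp (· == some false) (.push flag false) (.push flag true))) (F (S flag) a)
      (F (decide (a = b) :: S flag) a) 3 := by
    refine Runs.ite (t := 2) ?_
    simp only [F, ey]
    rcases lt_or_ge a b with hab | hab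
    · obtain ⟨e, he⟩ : ∃ e, b - a = e + 1 := ⟨b - a - 1, by omega⟩
      simpa [he, hab.ne, List.replicate_succ, F] using (pushF false (S flag) _ _ _).mono (by omega)
    · simp only [show b - a = 0 by omega, List.replicate_zero, List.head?_nil,
        Option.isSome_none, cond_false]
      refine Runs.ite (t := 1) ?_
      simp only [et]
      rcases hab.eq_or_lt with rfl | hab
      · have e : ((List.replicate b true).head? == some false) = false := by
          cases b <;> simp [List.replicate_succ]
        simpa [e, F] using pushF true (S flag) _ _ _
      · obtain ⟨e, he⟩ : ∃ e, a - b = e + 1 := ⟨a - b - 1, by omega⟩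
        simpa [he, hab.ne', List.replicate_succ, F] using pushF false (S flag) _ _ _
  have h₃ := Runs.loop (k := tmp) (u := Option.isSome) (t := 6)
    (P := .ite tmp (· == some true) (.push y true) .skip ;; .pop tmp ;; .push x true) a
    (fun i => F (decide (a = b) :: S flag) (a - i))
    (fun i hi => by
      obtain ⟨d, hd⟩ : ∃ d, a - i = d + 1 := ⟨a - i - 1, by omega⟩
      simp only [F, et, hd]
      rcases lt_or_ge d b with hb | hb
      · simp [show d + 1 - b = 0 by omega, show min (d + 1) b = d + 1 by omega,
          List.replicate_succ]
      · simp [show d + 1 - b = d - b + 1 by omega, List.replicate_succ])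
    (fun i hi => by
      obtain ⟨d, hd⟩ : ∃ d, a - i = d + 1 := ⟨a - i - 1, by omega⟩
      simp only [hd, show a - (i + 1) = d by omega]
      refine Runs.seq (t := 2) (t' := 3) (S' := G (decide (a = b) :: S flag)
        (List.replicate (d + 1 - b) false ++ List.replicate (min (d + 1) b) true)
        (List.replicate (b - d) true) (List.replicate (a - (d + 1)) true)) (Runs.ite ?_) ?_
      · simp only [F, et]
        rcases lt_or_ge d b with hb | hb
        · have := pushY true (decide (a = b) :: S flag) (List.replicate (d + 1) true)
            (List.replicate (b - (d + 1)) true) (List.replicate (a - (d + 1)) true)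
          simpa [F, show d + 1 - b = 0 by omega, show min (d + 1) b = d + 1 by omega,
            show b - d = b - (d + 1) + 1 by omega, List.replicate_succ] using this
        · have := Runs.skip (F (decide (a = b) :: S flag) (d + 1))
          simpa [F, show d + 1 - b = d - b + 1 by omega, show b - d = 0 by omega,
            show b - (d + 1) = 0 by omega, List.replicate_succ] using this
      · have := (popT (decide (a = b) :: S flag)
          (List.replicate (d + 1 - b) false ++ List.replicate (min (d + 1) b) true)
          (List.replicate (b - d) true) (List.replicate (a - (d + 1)) true)).seq
          (pushX true _ _ _ _)
        simp only [F, show a - d = a - (d + 1) + 1 by omega]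
        rcases lt_or_ge d b with hb | hb
        · simpa [show d + 1 - b = 0 by omega, show d - b = 0 by omega,
            show min (d + 1) b = d + 1 by omega, show min d b = d by omega,
            List.replicate_succ] using this
        · simpa [show d + 1 - b = d - b + 1 by omega, show min (d + 1) b = b by omega,
            show min d b = b by omega, List.replicate_succ] using this)
    (by simp [F, et])
  simp only [Nat.sub_zero, Nat.sub_self, hF0] at h₁ h₃
  rw [Function.update_eq_self] at h₁
  exact (h₁.seq (h₂.seq h₃)).mono (by omega)

end StackProg

/-! ### The registers of a machine that reads graphs -/

/-- The stacks of a machine working on an adjacency matrix. There are four loop variables, indexed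
by pairs of Booleans, and two copies of the matrix, indexed by Booleans; the variables
`(b, false)` and `(b, true)` run through the rows and the columns of the copy `b`. -/
inductive GraphReg : Type
  /-- the value of a loop variable, in unary -/
  | up (v : Bool × Bool)
  /-- the number of iterations that remain to be done for a loop variable, in unary -/
  | dn (v : Bool × Bool)
  /-- the entries of the matrix before the current one, in reverse order -/
  | lt (b : Bool)
  /-- the entries of the matrix from the current one on -/
  | rt (b : Bool)
  /-- the remaining input -/
  | inp
  /-- the output produced so far, in reverse order -/
  | rev
  /-- the final output -/
  | out
  /-- an auxiliary stack, empty between comparisons -/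
  | tmp
  /-- an auxiliary stack, receiving the results of comparisons -/
  | flag
deriving DecidableEq, Fintype

/-- The contents of the stacks between comparisons. -/
structure GraphMem : Type where
  /-- the number of iterations for each loop variable -/
  bound : Bool × Bool → ℕ
  /-- the value of each loop variable -/
  val : Bool × Bool → ℕ
  /-- the stacks `GraphReg.lt` -/
  lt : Bool → List Bool
  /-- the stacks `GraphReg.rt` -/
  rt : Bool → List Bool
  /-- the stack `GraphReg.inp` -/
  inp : List Bool
  /-- the stack `GraphReg.rev` -/
  rev : List Bool
  /-- the stack `GraphReg.out` -/
  out : List Bool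

namespace GraphMem

open Function StackProg

/-- The stacks described by `m`. -/
def contents (m : GraphMem) : GraphReg → List Bool
  | .up v => List.replicate (m.val v) true
  | .dn v => List.replicate (m.bound v - m.val v) true
  | .lt b => m.lt b
  | .rt b => m.rt b
  | .inp => m.inp
  | .rev => m.rev
  | .out => m.out
  | .tmp => []
  | .flag => []

/-- Give the value `x` to the loop variable `v`. -/
def setVal (m : GraphMem) (v : Bool × Bool) (x : ℕ) : GraphMem :=
  { m with val := update m.val v x }

/-- Put the word `w` on the tape `b`, with the head at position `x`. -/
def setTape (m : GraphMem) (b : Bool) (w : List Bool) (x : ℕ) : GraphMem :=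
  { m with lt := update m.lt b (w.take x).reverse, rt := update m.rt b (w.drop x) }

/-- Put the word `r` on the stack `GraphReg.rev`. -/
def setRev (m : GraphMem) (r : List Bool) : GraphMem := { m with rev := r }

/-- Started in `m`, the program `P` stops in `m'` within `t` steps. -/
def Exec (P : StackProg GraphReg) (m m' : GraphMem) (t : ℕ) : Prop := Runs P m.contents m'.contents t

/-- Started in `m`, the program `P` outputs the word `l` within `t` steps, and restores all other
stacks. -/
def Emits (P : StackProg GraphReg) (m : GraphMem) (l : List Bool) (t : ℕ) : Prop :=
  ∀ r, Exec P (m.setRev r) (m.setRev (l.reverse ++ r)) t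

theorem Exec.mono {P : StackProg GraphReg} {m m' : GraphMem} {t t' : ℕ} (h : Exec P m m' t)
    (ht : t ≤ t') : Exec P m m' t' := Runs.mono h ht

theorem Exec.seq {P Q : StackProg GraphReg} {m m' m'' : GraphMem} {t t' : ℕ} (h : Exec P m m' t)
    (h' : Exec Q m' m'' t') : Exec (P ;; Q) m m'' (t + t' + 1) := Runs.seq h h'

theorem Emits.mono {P : StackProg GraphReg} {m : GraphMem} {l : List Bool} {t t' : ℕ}
    (h : Emits P m l t) (ht : t ≤ t') : Emits P m l t' := fun r => (h r).mono ht

theorem Emits.seq {P Q : StackProg GraphReg} {m : GraphMem} {l l' : List Bool} {t t' : ℕ}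
    (h : Emits P m l t) (h' : Emits Q m l' t') : Emits (P ;; Q) m (l ++ l') (t + t' + 1) :=
  fun r => by simpa using (h r).seq (h' (l.reverse ++ r))

theorem Emits.push (m : GraphMem) (b : Bool) : Emits (push .rev b) m [b] 1 := fun r => by
  have := Runs.push GraphReg.rev b (m.setRev r).contents
  unfold Exec
  convert this using 1
  funext k
  cases k <;> simp [contents, setRev]

theorem Emits.concat {ι : Type} (P : ι → StackProg GraphReg) {m : GraphMem} {e : ι → List Bool}
    {t : ℕ} (l : List ι) (h : ∀ i ∈ l, Emits (P i) m (e i) t) :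
    Emits (concat (l.map P)) m (l.flatMap e) (l.length * (t + 1) + 1) := fun r => by
  have := Runs.concat P (fun l => (m.setRev ((l.flatMap e).reverse ++ r)).contents) (t := t) l []
    (fun i l₁ l₂ hl => by
      have := h i (by simp [hl]) ((l₁.flatMap e).reverse ++ r)
      simpa [Exec] using this)
  simpa [Exec] using this

theorem Emits.branchTop {k : GraphReg} {F : Bool → StackProg GraphReg} {m : GraphMem}
    {l : List Bool} {t : ℕ} {b : Bool} (hk : k ≠ .rev) (hb : (m.contents k).head? = some b)
    (h : Emits (F b) m l t) : Emits (branchTop k F) m l (t + 1) := fun r =>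
  Runs.branchTop (by cases k <;> simp_all [contents, setRev]) (h r)

/-! ### Loops and comparisons of loop variables -/

/-- Run `P` for all values of the loop variable `v`. -/
def forVar (v : Bool × Bool) (P : StackProg GraphReg) : StackProg GraphReg :=
  loop (.dn v) Option.isSome (P ;; pop (.dn v) ;; push (.up v) true) ;;
  loop (.up v) Option.isSome (pop (.up v) ;; push (.dn v) true)

/-- Branch on the equality of two loop variables. -/
def branchEq (u v : Bool × Bool) (F : Bool → StackProg GraphReg) : StackProg GraphReg :=
  compare (.up u) (.up v) .tmp .flag ;; branchTop .flag (fun b => pop .flag ;; F b)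

theorem Exec.forVar {v : Bool × Bool} {P : StackProg GraphReg} {t k : ℕ} (g : ℕ → GraphMem)
    (hb : ∀ x, (g x).bound v = k) (hv : ∀ x, (g x).val v = 0)
    (h : ∀ x < k, Exec P ((g x).setVal v x) ((g (x + 1)).setVal v x) t) :
    Exec (forVar v P) (g 0) (g k) (k * (t + 9) + 3) := by
  have h₁ := Runs.loop (k := GraphReg.dn v) (u := Option.isSome) (t := t + 4)
    (P := P ;; .pop (.dn v) ;; .push (.up v) true) k (fun x => ((g x).setVal v x).contents)
    (fun x hx => by
      obtain ⟨d, hd⟩ : ∃ d, k - x = d + 1 := ⟨k - x - 1, by omega⟩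
      simp [contents, setVal, hb, hd, List.replicate_succ])
    (fun x hx => by
      have := Runs.seq (h x hx) ((Runs.pop (GraphReg.dn v) _).seq (Runs.push (GraphReg.up v) true _))
      have := Runs.mono this (t' := t + 4) (by omega)
      convert this using 1
      obtain ⟨d, hd⟩ : ∃ d, k - x = d + 1 := ⟨k - x - 1, by omega⟩
      have hd' : k - (x + 1) = d := by omega
      funext r
      cases r with
      | up u => rcases eq_or_ne u v with rfl | hu <;>
          simp_all [contents, setVal, List.replicate_succ]
      | dn u => rcases eq_or_ne u v with rfl | hu <;>
          simp_all [contents, setVal, List.replicate_succ]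
      | _ => simp [contents, setVal])
    (by simp [contents, setVal, hb])
  have h₂ := Runs.loop (k := GraphReg.up v) (u := Option.isSome) (t := 3)
    (P := .pop (.up v) ;; .push (.dn v) true) k (fun x => ((g k).setVal v (k - x)).contents)
    (fun x hx => by
      obtain ⟨d, hd⟩ : ∃ d, k - x = d + 1 := ⟨k - x - 1, by omega⟩
      simp [contents, setVal, hd, List.replicate_succ])
    (fun x hx => by
      have := (Runs.pop (.up v) ((g k).setVal v (k - x)).contents).seq (Runs.push (.dn v) true _)
      convert this using 1
      obtain ⟨d, hd⟩ : ∃ d, k - x = d + 1 := ⟨k - x - 1, by omega⟩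
      have hd' : k - (x + 1) = d := by omega
      have hk : k - d = k - (d + 1) + 1 := by omega
      funext r
      cases r with
      | up u => rcases eq_or_ne u v with rfl | hu <;>
          simp_all [contents, setVal, List.replicate_succ]
      | dn u => rcases eq_or_ne u v with rfl | hu <;>
          simp_all [contents, setVal, List.replicate_succ]
      | _ => simp [contents, setVal])
    (by simp [contents, setVal])
  have e (x : ℕ) : (g x).setVal v 0 = g x := by
    rw [setVal, ← hv x, update_eq_self]
  simp only [Nat.sub_zero, Nat.sub_self, e] at h₁ h₂
  exact (h₁.seq h₂).mono (by ring_nf; omega)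

theorem Emits.branchEq {u v : Bool × Bool} (huv : u ≠ v) {F : Bool → StackProg GraphReg}
    {m : GraphMem} {l : List Bool} {t : ℕ} (h : Emits (F (decide (m.val u = m.val v))) m l t) :
    Emits (branchEq u v F) m l (t + m.val u * 14 + 20) := fun r => by
  have h₁ := Runs.compare (x := GraphReg.up u) (y := .up v) (tmp := .tmp) (flag := .flag)
    (by simpa using huv) (by simp) (by simp) (by simp) (by simp) (by simp)
    (S := (m.setRev r).contents) (a := m.val u) (b := m.val v) rfl rfl rfl
  have h₂ := (Runs.pop GraphReg.flag (update (m.setRev r).contents .flag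
    (decide (m.val u = m.val v) :: (m.setRev r).contents .flag)))
  simp only [update_self, List.tail_cons, update_idem, update_eq_self] at h₂
  exact (h₁.seq (Runs.branchTop (k := GraphReg.flag) (F := fun b => .pop .flag ;; F b)
    (b := decide (m.val u = m.val v)) (by rw [update_self]; rfl) (h₂.seq (h r)))).mono (by omega)

theorem Emits.forVar {v : Bool × Bool} {P : StackProg GraphReg} {t k : ℕ} {m : GraphMem}
    {e : ℕ → List Bool} (hb : m.bound v = k) (hv : m.val v = 0)
    (h : ∀ x < k, Emits P (m.setVal v x) (e x) t) :
    Emits (forVar v P) m ((List.range k).flatMap e) (k * (t + 9) + 3) := fun r => by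
  have := Exec.forVar (v := v) (P := P) (t := t) (k := k)
    (fun x => m.setRev (((List.range x).flatMap e).reverse ++ r)) (fun _ => hb) (fun _ => hv)
    (fun x hx => by
      have := h x hx (((List.range x).flatMap e).reverse ++ r)
      rw [← List.append_assoc, ← List.reverse_append] at this
      simpa [List.range_succ, setRev, setVal] using this)
  simpa using this

/-! ### Scanning an adjacency matrix -/

/-- Run `P` for all entries of the matrix on the tape `b`, row by row; when `P` is run, the entry
is at the top of the stack `GraphReg.rt b` and its coordinates are in the loop variables. -/
def scan (b : Bool) (P : StackProg GraphReg) : StackProg GraphReg :=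
  forVar (b, false) (forVar (b, true) (P ;; move (.rt b) (.lt b))) ;;
  moveAll (.lt b) (.rt b)

theorem Exec.moveRight (m : GraphMem) (b : Bool) {w : List Bool} {x : ℕ} (hx : x < w.length) :
    Exec (move (.rt b) (.lt b)) (m.setTape b w x) (m.setTape b w (x + 1)) 4 := by
  have := Runs.move (a := GraphReg.rt b) (b := .lt b) (by simp) (S := (m.setTape b w x).contents)
    (x := w[x]) (l := w.drop (x + 1)) (by simp [contents, setTape])
  unfold Exec
  convert this using 1
  funext r
  cases r with
  | lt c =>
    rcases eq_or_ne c b with rfl | hc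
    · simp only [contents, setTape, update_self, List.take_succ_eq_append_getElem hx,
        List.reverse_append, List.reverse_singleton, List.singleton_append, ne_eq, reduceCtorEq,
        not_false_eq_true, update_of_ne]
    · simp [contents, setTape, hc]
  | rt c =>
    rcases eq_or_ne c b with rfl | hc <;> simp_all [contents, setTape]
  | _ => simp [contents, setTape]

theorem Exec.rewind (m : GraphMem) (b : Bool) {w : List Bool} :
    Exec (moveAll (.lt b) (.rt b)) (m.setTape b w w.length) (m.setTape b w 0)
      (w.length * 5 + 1) := by
  have := Runs.moveAll (a := GraphReg.lt b) (b := .rt b) (by simp)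
    (S := (m.setTape b w w.length).contents) (l := w.reverse) (by simp [contents, setTape])
  rw [List.length_reverse] at this
  unfold Exec
  convert this using 1
  funext r
  cases r with
  | lt c =>
    rcases eq_or_ne c b with rfl | hc <;> simp_all [contents, setTape]
  | rt c =>
    rcases eq_or_ne c b with rfl | hc <;> simp_all [contents, setTape]
  | _ => simp [contents, setTape]

theorem Emits.scan {b : Bool} {P : StackProg GraphReg} {m : GraphMem} {w : List Bool} {k t : ℕ}
    {e : ℕ → ℕ → List Bool} (hw : w.length = k * k) (hb : ∀ d, m.bound (b, d) = k)
    (hv : ∀ d, m.val (b, d) = 0)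
    (h : ∀ i < k, ∀ j < k, Emits P
      (((m.setVal (b, false) i).setVal (b, true) j).setTape b w (i * k + j)) (e i j) t) :
    Emits (scan b P) (m.setTape b w 0) ((List.range k).flatMap fun i => (List.range k).flatMap (e i))
      (k * (k * (t + 14) + 12) + 3 + (k * k * 5 + 1) + 1) := fun r => by
  have h₁ (i : ℕ) (hi : i < k) (r' : List Bool) :
      Exec (GraphMem.forVar (b, true) (P ;; .move (.rt b) (.lt b)))
        (((m.setVal (b, false) i).setTape b w (i * k)).setRev r')
        (((m.setVal (b, false) i).setTape b w ((i + 1) * k)).setRev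
          (((List.range k).flatMap (e i)).reverse ++ r')) (k * (t + 14) + 3) := by
    have := Exec.forVar (v := (b, true)) (P := P ;; .move (.rt b) (.lt b)) (t := t + 5) (k := k)
      (fun j => ((m.setVal (b, false) i).setTape b w (i * k + j)).setRev
          (((List.range j).flatMap (e i)).reverse ++ r'))
      (fun _ => hb _) (fun _ => by simp [setVal, setTape, setRev, hv])
      (fun j hj => by
        have hlt : i * k + j < w.length := by
          rw [hw]
          calc i * k + j < i * k + k := by omega
            _ = (i + 1) * k := by ring
            _ ≤ k * k := Nat.mul_le_mul_right _ hi
        have h₁ := h i hi j hj (((List.range j).flatMap (e i)).reverse ++ r')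
        rw [← List.append_assoc, ← List.reverse_append] at h₁
        have h₂ := Exec.moveRight ((((m.setVal (b, false) i).setVal (b, true) j)).setRev
          (((List.range j).flatMap (e i) ++ e i j).reverse ++ r')) b hlt
        have := h₁.seq h₂
        rw [List.range_succ, List.flatMap_append, List.flatMap_singleton]
        exact this)
    simp only [add_zero, List.range_zero, List.flatMap_nil, List.reverse_nil,
      List.nil_append] at this
    rw [Nat.succ_mul]
    exact this
  have h₂ := Exec.forVar (v := (b, false)) (P := GraphMem.forVar (b, true) (P ;; .move (.rt b) (.lt b)))
    (t := k * (t + 14) + 3) (k := k)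
    (fun i => (m.setTape b w (i * k)).setRev
      (((List.range i).flatMap fun i => (List.range k).flatMap (e i)).reverse ++ r))
    (fun _ => hb _) (fun _ => hv _)
    (fun i hi => by
      have := h₁ i hi (((List.range i).flatMap fun i => (List.range k).flatMap (e i)).reverse ++ r)
      rw [← List.append_assoc, ← List.reverse_append] at this
      rw [List.range_succ, List.flatMap_append, List.flatMap_singleton]
      exact this)
  have h₃ := Exec.rewind (m.setRev
    (((List.range k).flatMap fun i => (List.range k).flatMap (e i)).reverse ++ r)) b (w := w)
  rw [hw] at h₃
  simp only [zero_mul, List.range_zero, List.flatMap_nil, List.reverse_nil, List.nil_append] at h₂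
  exact h₂.seq h₃

end GraphMem

namespace GraphMem

open Function StackProg

/-! ### A program for graphs whose adjacency is given by a local rule -/

/-- The memory holding a `k × k` matrix `w` on both tapes, all loop variables being ready to run
through `k` values. The matrix of size `0` gives the memory between two graphs. -/
def load (k : ℕ) (w inp rev : List Bool) : GraphMem where
  bound _ := k
  val _ := 0
  lt _ := []
  rt _ := w
  inp := inp
  rev := rev
  out := []

/-- Read the word of a graph from the input. -/
def readGraph : StackProg GraphReg :=
  loop .inp (· == some true) (pop .inp ;; push (.dn (false, false)) true ;;
    push (.dn (false, true)) true ;; push (.dn (true, false)) true ;;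
    push (.dn (true, true)) true) ;;
  pop .inp ;;
  forVar (false, false) (forVar (false, true)
    (branchTop .inp (fun b => push (.lt false) b ;; push (.lt true) b) ;; pop .inp)) ;;
  moveAll (.lt false) (.rt false) ;; moveAll (.lt true) (.rt true)

theorem exec_readGraph {k : ℕ} {w : List Bool} (hw : w.length = k * k) (l r : List Bool) :
    Exec readGraph (load 0 [] (List.replicate k true ++ false :: (w ++ l)) r) (load k w l r)
      (k * 11 + k * (k * 16 + 12) + k * k * 10 + 30) := by
  -- The memory after `x` entries have been read.
  let F (x : ℕ) : GraphMem := { load k [] (w.drop x ++ l) r with lt := fun _ => (w.take x).reverse }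
  have h₁ := Runs.loop (k := GraphReg.inp) (u := (· == some true)) (t := 9)
    (P := .pop .inp ;; .push (.dn (false, false)) true ;; .push (.dn (false, true)) true ;;
      .push (.dn (true, false)) true ;; .push (.dn (true, true)) true) k
    (fun x => (load x [] (List.replicate (k - x) true ++ false :: (w ++ l)) r).contents)
    (fun x hx => by
      obtain ⟨d, hd⟩ : ∃ d, k - x = d + 1 := ⟨k - x - 1, by omega⟩
      simp [contents, load, hd, List.replicate_succ])
    (fun x hx => by
      obtain ⟨d, hd⟩ : ∃ d, k - x = d + 1 := ⟨k - x - 1, by omega⟩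
      have hd' : k - (x + 1) = d := by omega
      have := (Runs.pop GraphReg.inp
        (load x [] (List.replicate (k - x) true ++ false :: (w ++ l)) r).contents).seq
        ((Runs.push (.dn (false, false)) true _).seq ((Runs.push (.dn (false, true)) true _).seq
        ((Runs.push (.dn (true, false)) true _).seq (Runs.push (.dn (true, true)) true _))))
      convert this using 1
      funext v
      cases v with
      | dn v => rcases v with ⟨_ | _, _ | _⟩ <;> simp [contents, load, List.replicate_succ]
      | _ => simp [contents, load, List.replicate_succ, hd, hd'])
    (by simp [contents, load])
  have h₂ : Runs (.pop .inp) (load k [] (List.replicate (k - k) true ++ false :: (w ++ l)) r).contents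
      (F 0).contents 1 := by
    convert Runs.pop GraphReg.inp _ using 1
    funext v
    cases v <;> simp [contents, load, F]
  have h₃ (x : ℕ) (hx : x < w.length) (i j : ℕ) :
      Exec (branchTop .inp (fun b => .push (.lt false) b ;; .push (.lt true) b) ;; .pop .inp)
        (((F x).setVal (false, false) i).setVal (false, true) j)
        (((F (x + 1)).setVal (false, false) i).setVal (false, true) j) 6 := by
    obtain ⟨b, hb⟩ : ∃ b, b = w[x] := ⟨_, rfl⟩
    have hd : w.drop x = b :: w.drop (x + 1) := by rw [hb, List.cons_getElem_drop_succ]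
    have ht : w.take (x + 1) = w.take x ++ [b] := by rw [hb, List.take_succ_eq_append_getElem hx]
    have := (Runs.branchTop (k := GraphReg.inp) (b := b)
      (F := fun b => .push (.lt false) b ;; .push (.lt true) b)
      (by simp [contents, F, load, setVal, hd])
      ((Runs.push (.lt false) b
        (((F x).setVal (false, false) i).setVal (false, true) j).contents).seq
        (Runs.push (.lt true) b _))).seq (Runs.pop .inp _)
    refine this.congr_right ?_
    funext v
    cases v with
    | lt b => cases b <;> simp [contents, F, load, setVal, ht]
    | inp => simp [contents, F, load, setVal, hd]
    | _ => simp [contents, F, load, setVal]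
  have h₄ (i : ℕ) (hi : i < k) := Exec.forVar (v := (false, true))
    (P := branchTop .inp (fun b => .push (.lt false) b ;; .push (.lt true) b) ;; .pop .inp)
    (t := 6) (k := k) (fun j => (F (i * k + j)).setVal (false, false) i) (fun _ => rfl)
    (fun _ => by simp [F, load, setVal])
    (fun j hj => h₃ (i * k + j) (by
      rw [hw]
      calc i * k + j < i * k + k := by omega
        _ = (i + 1) * k := by ring
        _ ≤ k * k := Nat.mul_le_mul_right _ hi) i j)
  have h₅ := Exec.forVar (v := (false, false)) (P := forVar (false, true)
    (branchTop .inp (fun b => .push (.lt false) b ;; .push (.lt true) b) ;; .pop .inp))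
    (t := k * (6 + 9) + 3) (k := k) (fun i => F (i * k)) (fun _ => rfl) (fun _ => rfl)
    (fun i hi => by
      have := h₄ i hi
      simp only [add_zero] at this
      simpa only [Nat.succ_mul] using this)
  have hF : (F (k * k)).contents = { load k [] l r with lt := fun _ => w.reverse }.contents := by
    simp [F, ← hw, load]
  have h₆ := Runs.moveAll (a := GraphReg.lt false) (b := .rt false) (by simp)
    (S := { load k [] l r with lt := fun _ => w.reverse }.contents) (l := w.reverse) rfl
  have h₇ := Runs.moveAll (a := GraphReg.lt true) (b := .rt true) (by simp)
    (S := update (update { load k [] l r with lt := fun _ => w.reverse }.contents (.rt false)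
      (w.reverse.reverse ++ [])) (.lt false) []) (l := w.reverse) (by simp [contents])
  unfold Exec at h₅ ⊢
  simp only [hF, zero_mul] at h₅
  have := (h₁.seq (h₂.seq (h₅.seq (h₆.seq h₇))))
  have := this.mono (t' := k * 11 + k * (k * 16 + 12) + k * k * 10 + 30) (by
    simp only [List.length_reverse, hw]
    ring_nf
    omega)
  refine this.congr_right ?_
  funext v
  cases v with
  | lt b => cases b <;> simp [contents, load]
  | rt b => cases b <;> simp [contents, load]
  | _ => simp [contents, load]

/-- Empty the tapes and the loop variables. -/
def unloadGraph : StackProg GraphReg :=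
  clear (.rt false) ;; clear (.rt true) ;; clear (.dn (false, false)) ;;
  clear (.dn (false, true)) ;; clear (.dn (true, false)) ;; clear (.dn (true, true))

theorem exec_unloadGraph (k : ℕ) (w l r : List Bool) :
    Exec unloadGraph (load k w l r) (load 0 [] l r) (w.length * 4 + k * 8 + 11) := by
  have := (Runs.clear (GraphReg.rt false) (S := (load k w l r).contents) (l := w) rfl).seq
    ((Runs.clear (GraphReg.rt true) (l := w) (by simp [contents, load])).seq
    ((Runs.clear (GraphReg.dn (false, false)) (l := List.replicate k true)
      (by simp [contents, load])).seq
    ((Runs.clear (GraphReg.dn (false, true)) (l := List.replicate k true)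
      (by simp [contents, load])).seq
    ((Runs.clear (GraphReg.dn (true, false)) (l := List.replicate k true)
      (by simp [contents, load])).seq
    (Runs.clear (GraphReg.dn (true, true)) (l := List.replicate k true)
      (by simp [contents, load]))))))
  have := this.mono (t' := w.length * 4 + k * 8 + 11) (by simp; omega)
  refine this.congr_right ?_
  funext v
  cases v with
  | dn v => rcases v with ⟨_ | _, _ | _⟩ <;> simp [contents, load]
  | rt b => cases b <;> simp [contents, load]
  | _ => simp [contents, load]

/-- A rule for the entries of an adjacency matrix on the vertices `(a, i, j)`, where `a` is in `κ`
and `i`, `j` are vertices of a given graph. The entry for `(a, i, j)` and `(a', i', j')` may depend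
on `a`, `a'`, on whether `i = i'`, `j = j'`, `i = j` and `i' = j'`, and on the entries `(i, j)` and
`(i', j')` of the given matrix. -/
abbrev EntryRule (κ : Type) : Type := κ → κ → Bool → Bool → Bool → Bool → Bool → Bool → Bool

/-- The word of the adjacency matrix made by an entry rule from the `k × k` matrix `w`. -/
def ruleWord {κ : Type} (s : List κ) (f : EntryRule κ) (k : ℕ) (w : List Bool) : List Bool :=
  ((s.flatMap fun _ => (List.range k).flatMap fun _ => (List.range k).flatMap fun _ => [true]) ++
    [false]) ++
  s.flatMap fun a => (List.range k).flatMap fun i => (List.range k).flatMap fun j =>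
    s.flatMap fun a' => (List.range k).flatMap fun i' => (List.range k).flatMap fun j' =>
      [f a a' (decide (i = i')) (decide (j = j')) (decide (i = j)) (decide (i' = j'))
        (w.getD (i * k + j) false) (w.getD (i' * k + j') false)]

/-- Output one entry of the new matrix. -/
def entryProg {κ : Type} (f : EntryRule κ) (a a' : κ) : StackProg GraphReg :=
  branchEq (false, false) (true, false) fun b₁ =>
  branchEq (false, true) (true, true) fun b₂ =>
  branchEq (false, false) (false, true) fun b₃ =>
  branchEq (true, false) (true, true) fun b₄ =>
  branchTop (.rt false) fun b₅ => branchTop (.rt true) fun b₆ =>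
  push .rev (f a a' b₁ b₂ b₃ b₄ b₅ b₆)

/-- Read a graph and output the word of the new graph. -/
def ruleProg {κ : Type} (s : List κ) (f : EntryRule κ) : StackProg GraphReg :=
  readGraph ;;
  (((concat (s.map fun _ => forVar (false, false) (forVar (false, true) (push .rev true)))) ;;
    push .rev false) ;;
  concat (s.map fun a => scan false (concat (s.map fun a' => scan true (entryProg f a a'))))) ;;
  unloadGraph

theorem emits_entryProg {κ : Type} (f : EntryRule κ) (a a' : κ) {m : GraphMem} {k : ℕ}
    {b b' : Bool} (hm : ∀ v, m.val v ≤ k) (hb : (m.rt false).head? = some b)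
    (hb' : (m.rt true).head? = some b') :
    Emits (entryProg f a a') m
      [f a a' (decide (m.val (false, false) = m.val (true, false)))
        (decide (m.val (false, true) = m.val (true, true)))
        (decide (m.val (false, false) = m.val (false, true)))
        (decide (m.val (true, false) = m.val (true, true))) b b'] (k * 56 + 83) := by
  have h₁ := hm (false, false)
  have h₂ := hm (false, true)
  have h₃ := hm (true, false)
  refine (Emits.branchEq (by simp) (Emits.branchEq (by simp) (Emits.branchEq (by simp)
    (Emits.branchEq (t := 3) (by simp) (Emits.branchTop (k := .rt false) (t := 2) (by simp) hb
      (Emits.branchTop (k := .rt true) (t := 1) (by simp) hb' ?_)))))).mono (by omega)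
  exact Emits.push _ _

open Polynomial in
theorem exec_ruleProg {κ : Type} (s : List κ) (f : EntryRule κ) :
    ∃ p : ℕ[X], ∀ (k : ℕ) (w : List Bool), w.length = k * k → ∀ l r,
      Exec (ruleProg s f) (load 0 [] (List.replicate k true ++ false :: (w ++ l)) r)
        (load 0 [] l ((ruleWord s f k w).reverse ++ r)) (p.eval k) := by
  let scanTime (t : ℕ[X]) : ℕ[X] :=
    X * (X * (t + 14) + 12) + 3 + (X * X * 5 + 1) + 1
  let concatTime (t : ℕ[X]) : ℕ[X] := (s.length : ℕ[X]) * (t + 1) + 1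
  let p₁ : ℕ[X] := X * 11 + X * (X * 16 + 12) + X * X * 10 + 30
  let p₂ : ℕ[X] := concatTime (X * (X * (1 + 9) + 3 + 9) + 3) + 1 + 1
  let p₃ : ℕ[X] := concatTime (scanTime (concatTime (scanTime (X * 56 + 83))))
  let p₄ : ℕ[X] := X * X * 4 + X * 8 + 11
  refine ⟨p₁ + ((p₂ + p₃ + 1) + p₄ + 1) + 1, fun k w hw l r => ?_⟩
  have h₁ := exec_readGraph hw l r
  have h₂ : Emits (concat (s.map fun _ => forVar (false, false) (forVar (false, true)
      (.push .rev true))) ;; .push .rev false) (load k w l r)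
      ((s.flatMap fun _ => (List.range k).flatMap fun _ => (List.range k).flatMap fun _ => [true]) ++
        [false]) (p₂.eval k) := by
    refine Emits.mono (Emits.seq (Emits.concat _ (t := k * (k * (1 + 9) + 3 + 9) + 3) s
      (fun a _ => Emits.forVar rfl rfl fun i _ => Emits.forVar rfl ?_
        fun j _ => Emits.push _ _)) (Emits.push _ _)) ?_
    · simp [load, setVal]
    · simp [p₂, concatTime]
  have h₃ : Emits (concat (s.map fun a => scan false (concat (s.map fun a' =>
      scan true (entryProg f a a'))))) (load k w l r)
      (s.flatMap fun a => (List.range k).flatMap fun i => (List.range k).flatMap fun j =>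
        s.flatMap fun a' => (List.range k).flatMap fun i' => (List.range k).flatMap fun j' =>
          [f a a' (decide (i = i')) (decide (j = j')) (decide (i = j)) (decide (i' = j'))
            (w.getD (i * k + j) false) (w.getD (i' * k + j') false)]) (p₃.eval k) := by
    have e (m : GraphMem) (b : Bool) (hl : m.lt b = []) (hr : m.rt b = w) :
        m.setTape b w 0 = m := by
      have e₁ : update m.lt b [] = m.lt := by rw [← hl, update_eq_self]
      have e₂ : update m.rt b w = m.rt := by rw [← hr, update_eq_self]
      simp [setTape, e₁, e₂]
    have hlt {i j : ℕ} (hi : i < k) (hj : j < k) : i * k + j < w.length := by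
      rw [hw]
      calc i * k + j < i * k + k := by omega
        _ = (i + 1) * k := by ring
        _ ≤ k * k := Nat.mul_le_mul_right _ hi
    refine Emits.mono (Emits.concat _ (t := (scanTime (concatTime (scanTime
      (X * 56 + 83)))).eval k) s fun a _ => ?_) (by simp [p₃, concatTime])
    rw [← e (load k w l r) false rfl rfl]
    refine Emits.mono (Emits.scan (t := (concatTime (scanTime (X * 56 + 83))).eval k) hw
      (fun _ => rfl) (fun _ => rfl) fun i hi j hj => ?_) (by simp [scanTime])
    refine Emits.mono (Emits.concat _ (t := (scanTime (X * 56 + 83)).eval k) s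
      fun a' _ => ?_) (by simp [concatTime])
    rw [← e ((((load k w l r).setVal (false, false) i).setVal (false, true) j).setTape false w
      (i * k + j)) true (by simp [setTape, setVal, load]) (by simp [setTape, setVal, load])]
    refine Emits.mono (Emits.scan (t := k * 56 + 83) hw (fun _ => rfl)
      (fun _ => by simp [setTape, setVal, load]) fun i' hi' j' hj' => ?_) (by simp [scanTime])
    have := emits_entryProg f a a' (k := k) (b := w.getD (i * k + j) false)
      (b' := w.getD (i' * k + j') false) (m := ((((((load k w l r).setVal (false, false) i).setVal
        (false, true) j).setTape false w (i * k + j)).setVal (true, false) i').setVal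
        (true, true) j').setTape true w (i' * k + j'))
      (by rintro ⟨_ | _, _ | _⟩ <;> simp [setTape, setVal, load, hi.le, hj.le, hi'.le, hj'.le])
      (by simp [setTape, setVal, hlt hi hj])
      (by simp [setTape, setVal, hlt hi' hj'])
    simpa [setTape, setVal] using this
  have h₄ := exec_unloadGraph k w l ((ruleWord s f k w).reverse ++ r)
  refine (h₁.seq (((h₂.seq h₃) r).seq h₄)).mono ?_
  simp [p₁, p₄, hw]

theorem _root_.Polynomial.eval_le_eval_of_le_nat (p : Polynomial ℕ) {a b : ℕ} (h : a ≤ b) :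
    p.eval a ≤ p.eval b := by
  simp only [Polynomial.eval_eq_sum_range]
  exact Finset.sum_le_sum fun i _ => Nat.mul_le_mul_left _ (Nat.pow_le_pow_left h i)

theorem length_ruleWord {κ : Type} (s : List κ) (f : EntryRule κ) (k : ℕ) (w : List Bool) :
    (ruleWord s f k w).length =
      s.length * (k * k) + 1 + s.length * (k * (k * (s.length * (k * k)))) := by
  simp [ruleWord, List.length_flatMap]
  ring

open Polynomial in
/-- A map on graphs that is given by an entry rule is computed on pairs in polynomial time. -/
theorem polyTime_of_entryRule {κ : Type} (s : List κ) (f : EntryRule κ) (F : FinGraph → FinGraph)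
    (w : FinGraph → List Bool) (hw : ∀ G, (w G).length = G.order * G.order)
    (hG : ∀ G : FinGraph, G.encode = List.replicate G.order true ++ false :: w G)
    (hF : ∀ G, (F G).encode = ruleWord s f G.order (w G)) :
    Nonempty (Turing.TM2ComputableInPolyTime FinGraph.encodePair FinGraph.encodePair
      (fun P => (F P.1, F P.2))) := by
  obtain ⟨p, hp⟩ := exec_ruleProg s f
  let q : ℕ[X] := (s.length : ℕ[X]) * (X * X) + 1 +
    (s.length : ℕ[X]) * (X * (X * ((s.length : ℕ[X]) * (X * X))))
  have hq (G : FinGraph) : (ruleWord s f G.order (w G)).length = q.eval G.order := by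
    simp [q, length_ruleWord]
  refine polyTime_of_runs (ruleProg s f ;; ruleProg s f ;; moveAll .rev .out) .inp .out
    (p + (p + ((q + q) * 5 + 1) + 1) + 1) ?_
  rintro ⟨G, H⟩
  have h₁ := hp G.order (w G) (hw G) (H.encode ++ []) []
  have h₂ := hp H.order (w H) (hw H) [] ((ruleWord s f G.order (w G)).reverse ++ [])
  have e : List.replicate H.order true ++ false :: (w H ++ []) = H.encode ++ [] := by simp [hG H]
  rw [e] at h₂
  have h₃ := Runs.moveAll (a := GraphReg.rev) (b := .out) (by simp)
    (S := (load 0 [] [] ((ruleWord s f H.order (w H)).reverse ++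
      ((ruleWord s f G.order (w G)).reverse ++ []))).contents)
    (l := (ruleWord s f H.order (w H)).reverse ++ ((ruleWord s f G.order (w G)).reverse ++ [])) rfl
  have hle₁ : G.order ≤ (FinGraph.encodePair (G, H)).length := by
    simp [FinGraph.encodePair, hG]
  have hle₂ : H.order ≤ (FinGraph.encodePair (G, H)).length := by
    simp [FinGraph.encodePair, hG]
    omega
  have := ((Runs.seq h₁ (Runs.seq h₂ h₃)).mono (t' := (p + (p + ((q + q) * 5 + 1) + 1) + 1).eval
    (FinGraph.encodePair (G, H)).length) (by
      have a₁ := p.eval_le_eval_of_le_nat hle₁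
      have a₂ := p.eval_le_eval_of_le_nat hle₂
      have a₃ := q.eval_le_eval_of_le_nat hle₁
      have a₄ := q.eval_le_eval_of_le_nat hle₂
      simp only [List.length_append, List.length_reverse, List.length_nil, hq, eval_add, eval_mul,
        eval_one, eval_ofNat]
      omega)).congr_right (S'' := update (fun _ => []) .out (FinGraph.encodePair (F G, F H))) (by
        funext v
        cases v <;> simp [contents, load, FinGraph.encodePair, hF])
  convert this using 1
  funext v
  cases v <;> simp [contents, load, FinGraph.encodePair, hG]

end GraphMem

/-! ### Graphs obtained from sparse graphs by complementing between classes -/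

section Twist

variable {V W I : Type*}

/-- The graph obtained from `S` by complementing the adjacency between the vertices of class `k`
and the vertices of class `k'` whenever `ℓ k k'` holds. -/
def SimpleGraph.twist (S : SimpleGraph V) (κ : V → I) (ℓ : I → I → Prop)
    (hℓ : ∀ k k', ℓ k k' ↔ ℓ k' k) : SimpleGraph V where
  Adj u v := u ≠ v ∧ (ℓ (κ u) (κ v) ↔ ¬S.Adj u v)
  symm := ⟨fun u v h => ⟨h.1.symm, by rw [hℓ, S.adj_comm]; exact h.2⟩⟩
  loopless := ⟨fun _ h => h.1 rfl⟩

variable {S : SimpleGraph V} {κ : V → I} {ℓ : I → I → Prop} {hℓ : ∀ k k', ℓ k k' ↔ ℓ k' k}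

theorem SimpleGraph.adj_iff_twist_adj {u v : V} (h : u ≠ v) :
    S.Adj u v ↔ (ℓ (κ u) (κ v) ↔ ¬(S.twist κ ℓ hℓ).Adj u v) := by
  simp only [twist, h, ne_eq, not_false_eq_true, true_and]
  tauto

open Classical in
/-- If all classes are much larger than the degrees of `S`, then two vertices have classes that
behave alike if and only if their neighborhoods differ in few vertices only. -/
theorem SimpleGraph.twist_similar_iff [Fintype V] {d : ℕ}
    (hd : ∀ u, (Finset.univ.filter (S.Adj u)).card ≤ d)
    (hκ : ∀ k, 4 * d + 4 < (Finset.univ.filter fun v => κ v = k).card) (u v : V) :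
    (∀ k, ℓ (κ u) k ↔ ℓ (κ v) k) ↔ (Finset.univ.filter fun x =>
      ¬((S.twist κ ℓ hℓ).Adj u x ↔ (S.twist κ ℓ hℓ).Adj v x)).card ≤ 2 * d + 2 := by
  let X : Finset V := (Finset.univ.filter (S.Adj u) ∪ Finset.univ.filter (S.Adj v)) ∪ {u, v}
  have hX : X.card ≤ 2 * d + 2 := by
    have h₁ := Finset.card_union_le (Finset.univ.filter (S.Adj u) ∪ Finset.univ.filter (S.Adj v))
      {u, v}
    have h₂ := Finset.card_union_le (Finset.univ.filter (S.Adj u)) (Finset.univ.filter (S.Adj v))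
    have h₃ : ({u, v} : Finset V).card ≤ 2 := Finset.card_le_two
    have h₄ := hd u
    have h₅ := hd v
    exact h₁.trans (by omega)
  have hadj (x : V) (hx : x ∉ X) : ((S.twist κ ℓ hℓ).Adj u x ↔ ℓ (κ u) (κ x)) ∧
      ((S.twist κ ℓ hℓ).Adj v x ↔ ℓ (κ v) (κ x)) := by
    simp only [X, Finset.mem_union, Finset.mem_filter, Finset.mem_univ, true_and,
      Finset.mem_insert, Finset.mem_singleton, not_or] at hx
    have h₁ : u ≠ x := fun e => hx.2.1 e.symm
    have h₂ : v ≠ x := fun e => hx.2.2 e.symm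
    simp [twist, hx.1.1, hx.1.2, h₁, h₂]
  constructor
  · intro h
    refine le_trans (Finset.card_le_card fun x hx => ?_) hX
    by_contra hxX
    rw [Finset.mem_filter, (hadj x hxX).1, (hadj x hxX).2] at hx
    exact hx.2 (h _)
  · intro hc k
    by_contra hk
    have hsub : (Finset.univ.filter fun v => κ v = k) ⊆ (Finset.univ.filter fun x =>
        ¬((S.twist κ ℓ hℓ).Adj u x ↔ (S.twist κ ℓ hℓ).Adj v x)) ∪ X := by
      intro x hx
      obtain rfl : κ x = k := (Finset.mem_filter.1 hx).2
      by_cases hxX : x ∈ X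
      · exact Finset.mem_union_right _ hxX
      · refine Finset.mem_union_left _ (Finset.mem_filter.2 ⟨Finset.mem_univ _, ?_⟩)
        rwa [(hadj x hxX).1, (hadj x hxX).2]
    have h₁ := (Finset.card_le_card hsub).trans (Finset.card_union_le _ _)
    have h₂ := hκ k
    omega

open Classical in
theorem Finset.card_filter_similar [Fintype V] [Fintype I] (ℓ : I → I → Prop) {κ : V → I}
    {w : I → ℕ} (hκ : ∀ k, (Finset.univ.filter fun v => κ v = k).card = w k) (k : I) :
    (Finset.univ.filter fun x => ∀ m, ℓ k m ↔ ℓ (κ x) m).card =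
      ∑ k' ∈ Finset.univ.filter fun k' => ∀ m, ℓ k m ↔ ℓ k' m, w k' := by
  rw [Finset.card_eq_sum_card_fiberwise (f := κ)
    (t := Finset.univ.filter fun k' => ∀ m, ℓ k m ↔ ℓ k' m) (fun x hx => by simpa using hx)]
  refine Finset.sum_congr rfl fun k' hk' => ?_
  rw [← hκ k', Finset.filter_filter]
  congr 1
  ext x
  simp only [Finset.mem_filter, Finset.mem_univ, true_and, and_iff_right_iff_imp]
  rintro rfl
  exact (Finset.mem_filter.1 hk').2

open Classical in
/-- The sparse graph can be recovered up to isomorphism from a twisted graph, if the sizes of the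
classes are large and tell sets of classes apart. -/
theorem SimpleGraph.adj_iff_of_twist_iso [Fintype V] [Fintype W] [Fintype I] {T : SimpleGraph W}
    {μ : W → I} {d : ℕ} {w : I → ℕ} (hd : ∀ u, (Finset.univ.filter (S.Adj u)).card ≤ d)
    (hd' : ∀ u, (Finset.univ.filter (T.Adj u)).card ≤ d)
    (hκ : ∀ k, (Finset.univ.filter fun v => κ v = k).card = w k)
    (hμ : ∀ k, (Finset.univ.filter fun v => μ v = k).card = w k)
    (hw : ∀ k, 4 * d + 4 < w k) (hinj : Function.Injective fun X : Finset I => ∑ k ∈ X, w k)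
    (f : S.twist κ ℓ hℓ ≃g T.twist μ ℓ hℓ) (u v : V) : T.Adj (f u) (f v) ↔ S.Adj u v := by
  have similar (u v : V) : (∀ k, ℓ (κ u) k ↔ ℓ (κ v) k) ↔
      (∀ k, ℓ (μ (f u)) k ↔ ℓ (μ (f v)) k) := by
    rw [twist_similar_iff (hℓ := hℓ) hd (fun k => by rw [hκ]; exact hw k),
      twist_similar_iff (hℓ := hℓ) hd' (fun k => by rw [hμ]; exact hw k)]
    have : (Finset.univ.filter fun x =>
        ¬((S.twist κ ℓ hℓ).Adj u x ↔ (S.twist κ ℓ hℓ).Adj v x)).card = (Finset.univ.filter fun x =>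
        ¬((T.twist μ ℓ hℓ).Adj (f u) x ↔ (T.twist μ ℓ hℓ).Adj (f v) x)).card := by
      refine Finset.card_equiv f.toEquiv fun x => ?_
      simp only [Finset.mem_filter, Finset.mem_univ, true_and, RelIso.coe_fn_toEquiv,
        f.map_adj_iff]
    rw [this]
  have same (u : V) (m : I) : ℓ (κ u) m ↔ ℓ (μ (f u)) m := by
    have hcard : (Finset.univ.filter fun x => ∀ m, ℓ (κ u) m ↔ ℓ (κ x) m).card =
        (Finset.univ.filter fun x => ∀ m, ℓ (μ (f u)) m ↔ ℓ (μ x) m).card := by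
      refine Finset.card_equiv f.toEquiv fun x => ?_
      simpa using similar u x
    rw [Finset.card_filter_similar ℓ hκ, Finset.card_filter_similar ℓ hμ] at hcard
    have hmem : κ u ∈ Finset.univ.filter fun k' => ∀ m, ℓ (μ (f u)) m ↔ ℓ k' m := by
      rw [← hinj hcard]
      simp
    exact ((Finset.mem_filter.1 hmem).2 m).symm
  rcases eq_or_ne u v with rfl | huv
  · simp
  · rw [adj_iff_twist_adj (κ := μ) (hℓ := hℓ) (f.injective.ne huv),
      adj_iff_twist_adj (κ := κ) (hℓ := hℓ) huv, f.map_adj_iff]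
    have : ℓ (μ (f u)) (μ (f v)) ↔ ℓ (κ u) (κ v) := by
      rw [← same u, hℓ, ← same v, hℓ]
    rw [this]

end Twist

/-! ### The sparse graph of a graph -/

namespace ChainGraph

/-- The kinds of the vertices that are in use: `none` for the hubs, which stand for the vertices of
the given graph, and `some (c, q)` for the vertices at position `q` of the chains in the copy `c`.
-/
abbrev Core (s : ℕ) : Type := Option (Fin 3 × Fin (2 * s + 1))

/-- The class of a kind in use: along a chain the classes are `1, …, s, s + 1, s, …, 1`, and hubs
have class `0`. -/
def coreClass {s : ℕ} : Core s → Fin (s + 2)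
  | none => 0
  | some (_, q) => ⟨min (q + 1) (2 * s + 1 - q), by omega⟩

/-- The number of kinds of class `k`. The powers of two tell the classes, and also the sets of
classes, apart; the other factor makes all classes large. -/
def kindCount (s : ℕ) (k : Fin (s + 2)) : ℕ := (32 + Fintype.card (Core s)) * 2 ^ (k : ℕ)

/-- All kinds of vertices: those in use, and further ones for isolated vertices by which the class
`k` is brought to its size. -/
abbrev Kind (s : ℕ) : Type :=
  Core s ⊕ Σ k : Fin (s + 2),
    Fin (kindCount s k - (Finset.univ.filter fun a : Core s => coreClass a = k).card)

/-- The class of a kind. -/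
def kindClass {s : ℕ} : Kind s → Fin (s + 2)
  | .inl a => coreClass a
  | .inr x => x.1

theorem card_filter_kindClass (s : ℕ) (k : Fin (s + 2)) :
    (Finset.univ.filter fun a : Kind s => kindClass a = k).card = kindCount s k := by
  have hle : (Finset.univ.filter fun a : Core s => coreClass a = k).card ≤ kindCount s k :=
    (Finset.card_le_univ _).trans ((Nat.le_add_left _ _).trans
      (Nat.le_mul_of_pos_right _ (by positivity)))
  have h : (Finset.univ.filter fun a : Kind s => kindClass a = k) =
      (Finset.univ.filter fun a : Core s => coreClass a = k).disjSum
        (Finset.univ.filter fun x => x.1 = k) := by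
    ext (a | x) <;>
      simp only [Finset.mem_filter, Finset.mem_univ, true_and, Finset.inl_mem_disjSum,
        Finset.inr_mem_disjSum] <;> rfl
  have h' : (Finset.univ.filter fun x : (Σ k : Fin (s + 2), Fin (kindCount s k -
      (Finset.univ.filter fun a : Core s => coreClass a = k).card)) => x.1 = k) =
      Finset.univ.map ⟨Sigma.mk k, sigma_mk_injective⟩ := by
    ext ⟨k', y⟩
    simp only [Finset.mem_filter, Finset.mem_univ, true_and, Finset.mem_map,
      Function.Embedding.coeFn_mk]
    constructor
    · rintro rfl
      exact ⟨y, rfl⟩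
    · rintro ⟨y', e⟩
      exact (congrArg Sigma.fst e).symm
  rw [h, Finset.card_disjSum, h', Finset.card_map, Finset.card_univ, Fintype.card_fin]
  omega

/-- The directed links from `(a, i, j)` to `(a', i', j')`, where `e₁`, …, `e₄` stand for `i = i'`,
`j = j'`, `i = j`, `i' = j'` and `x` stands for the adjacency of `i` and `j`. The chains from the
hub of `i` to the hub of `j` are complete if `i` and `j` are adjacent and lack the last link
otherwise. -/
def linkRule {s : ℕ} : Kind s → Kind s → Prop → Prop → Prop → Prop → Prop → Prop
  | .inl none, .inl (some (_, q)), e₁, _, e₃, _, _ => (q : ℕ) = 0 ∧ e₃ ∧ e₁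
  | .inl (some (c, q)), .inl (some (c', q')), e₁, e₂, _, _, _ =>
    c = c' ∧ (q : ℕ) + 1 = q' ∧ e₁ ∧ e₂
  | .inl (some (_, q)), .inl none, _, e₂, _, e₄, x => (q : ℕ) = 2 * s ∧ e₄ ∧ e₂ ∧ x
  | _, _, _, _, _, _, _ => False

variable {s : ℕ} {ι : Type*}

/-- The directed links for the graph `A`. -/
def Link (A : SimpleGraph ι) (u v : Kind s × ι × ι) : Prop :=
  linkRule u.1 v.1 (u.2.1 = v.2.1) (u.2.2 = v.2.2) (u.2.1 = u.2.2) (v.2.1 = v.2.2)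
    (A.Adj u.2.1 u.2.2)

/-- The sparse graph of the graph `A`. -/
def chainGraph (s : ℕ) (A : SimpleGraph ι) : SimpleGraph (Kind s × ι × ι) :=
  SimpleGraph.fromRel (Link A)

/-- The hub of a vertex. -/
def hub (s : ℕ) (i : ι) : Kind s × ι × ι := (.inl none, i, i)

/-- A vertex on a chain. -/
def chain (c : Fin 3) (q : Fin (2 * s + 1)) (i j : ι) : Kind s × ι × ι := (.inl (some (c, q)), i, j)

theorem hub_injective : Function.Injective (hub s : ι → _) := fun i j h => by
  simpa [hub] using h

variable {A : SimpleGraph ι}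

theorem hub_adj {i j : ι} {w : Kind s × ι × ι} :
    (chainGraph s A).Adj (.inl none, i, j) w ↔ i = j ∧ ∃ c q x y, w = chain c q x y ∧
      ((q : ℕ) = 0 ∧ x = i ∨ (q : ℕ) = 2 * s ∧ y = i ∧ A.Adj x y) := by
  obtain ⟨(_ | ⟨c, q⟩) | z, x, y⟩ := w
  · simp [chainGraph, Link, linkRule, chain]
  · simp [chainGraph, Link, linkRule, chain]
    aesop
  · simp [chainGraph, Link, linkRule, chain]

theorem chain_adj_chain {c c' : Fin 3} {q q' : Fin (2 * s + 1)} {i j i' j' : ι} :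
    (chainGraph s A).Adj (chain c q i j) (chain c' q' i' j') ↔
      c = c' ∧ ((q : ℕ) + 1 = q' ∨ (q' : ℕ) + 1 = q) ∧ i = i' ∧ j = j' := by
  simp [chainGraph, Link, linkRule, chain]
  constructor
  · rintro ⟨-, ⟨rfl, h, rfl, rfl⟩ | ⟨rfl, h, rfl, rfl⟩⟩ <;> simp [h]
  · rintro ⟨rfl, h, rfl, rfl⟩
    refine ⟨fun _ e => ?_, by simpa using h⟩
    subst e
    omega

theorem not_pad_adj {z} {i j : ι} {w : Kind s × ι × ι} :
    ¬(chainGraph s A).Adj (.inr z, i, j) w := by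
  obtain ⟨(_ | ⟨c, q⟩) | z, x, y⟩ := w <;> simp [chainGraph, Link, linkRule]

/-- The neighbor of a chain vertex on the side of the start of the chain. -/
def prev (c : Fin 3) (q : Fin (2 * s + 1)) (i j : ι) : Kind s × ι × ι :=
  if (q : ℕ) = 0 then hub s i else chain c ⟨q - 1, by omega⟩ i j

/-- The neighbor of a chain vertex on the side of the end of the chain, if there is one. -/
def next (c : Fin 3) (q : Fin (2 * s + 1)) (i j : ι) : Kind s × ι × ι :=
  if h : (q : ℕ) = 2 * s then hub s j else chain c ⟨q + 1, by omega⟩ i j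

theorem eq_prev_or_eq_next {c : Fin 3} {q : Fin (2 * s + 1)} {i j : ι} {w : Kind s × ι × ι}
    (h : (chainGraph s A).Adj (chain c q i j) w) : w = prev c q i j ∨ w = next c q i j := by
  obtain ⟨(_ | ⟨c', q'⟩) | z, x, y⟩ := w
  · obtain ⟨rfl, c', q', x', y', e, h⟩ := hub_adj.1 h.symm
    obtain ⟨⟨rfl, rfl⟩, rfl, rfl⟩ : (c = c' ∧ q = q') ∧ i = x' ∧ j = y' := by
      simpa [chain] using e
    rcases h with ⟨hq, rfl⟩ | ⟨hq, rfl, -⟩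
    · left
      rw [prev, if_pos hq]
      rfl
    · right
      rw [next, dif_pos hq]
      rfl
  · obtain ⟨rfl, hq, rfl, rfl⟩ := chain_adj_chain.1 h
    rcases hq with hq | hq
    · right
      rw [next, dif_neg (by omega)]
      simp [chain, Fin.ext_iff, ← hq]
    · left
      rw [prev, if_neg (by omega)]
      simp [chain, ← hq]
  · exact absurd h.symm not_pad_adj

/-! ### Degrees -/

section Degree

open Classical

variable [Fintype ι]

theorem card_adj_le_two {u : Kind s × ι × ι} (hu : ∀ i, u ≠ hub s i) :
    (Finset.univ.filter ((chainGraph s A).Adj u)).card ≤ 2 := by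
  obtain ⟨(_ | ⟨c, q⟩) | z, i, j⟩ := u
  · have : Finset.univ.filter ((chainGraph s A).Adj (.inl none, i, j)) = ∅ := by
      refine Finset.filter_eq_empty_iff.2 fun w _ h => ?_
      obtain ⟨rfl, -⟩ := hub_adj.1 h
      exact hu i rfl
    simp [this]
  · refine (Finset.card_le_card (t := {prev c q i j, next c q i j}) fun w hw => ?_).trans
      Finset.card_le_two
    simpa using eq_prev_or_eq_next (Finset.mem_filter.1 hw).2
  · have : Finset.univ.filter ((chainGraph s A).Adj (.inr z, i, j)) = ∅ :=
      Finset.filter_eq_empty_iff.2 fun w _ h => not_pad_adj h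
    simp [this]

theorem three_le_card_adj_hub (i : ι) :
    3 ≤ (Finset.univ.filter ((chainGraph s A).Adj (hub s i))).card := by
  have h : (Finset.univ.image fun c : Fin 3 => chain (s := s) c 0 i i) ⊆
      Finset.univ.filter ((chainGraph s A).Adj (hub s i)) := by
    intro w hw
    obtain ⟨c, -, rfl⟩ := Finset.mem_image.1 hw
    exact Finset.mem_filter.2 ⟨Finset.mem_univ _,
      hub_adj.2 ⟨rfl, c, 0, i, i, rfl, Or.inl ⟨rfl, rfl⟩⟩⟩
  refine le_trans ?_ (Finset.card_le_card h)
  rw [Finset.card_image_of_injective _ (fun c c' e => by simpa [chain] using e)]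
  simp

theorem card_adj_le [Nonempty ι] (u : Kind s × ι × ι) :
    (Finset.univ.filter ((chainGraph s A).Adj u)).card ≤ 6 * Fintype.card ι := by
  have hpos : 0 < Fintype.card ι := Fintype.card_pos
  by_cases hu : ∀ i, u ≠ hub s i
  · exact (card_adj_le_two hu).trans (by omega)
  · push Not at hu
    obtain ⟨i, rfl⟩ := hu
    have h : Finset.univ.filter ((chainGraph s A).Adj (hub s i)) ⊆
        (Finset.univ.image fun x : Fin 3 × ι => chain (s := s) x.1 0 i x.2) ∪
        (Finset.univ.image fun x : Fin 3 × ι => chain (s := s) x.1 (Fin.last _) x.2 i) := by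
      intro w hw
      obtain ⟨-, c, q, x, y, rfl, h⟩ := hub_adj.1 (Finset.mem_filter.1 hw).2
      rcases h with ⟨h, rfl⟩ | ⟨h, rfl, -⟩
      · obtain rfl : q = 0 := Fin.ext h
        exact Finset.mem_union_left _ (Finset.mem_image.2 ⟨(c, y), Finset.mem_univ _, rfl⟩)
      · obtain rfl : q = Fin.last _ := Fin.ext h
        exact Finset.mem_union_right _ (Finset.mem_image.2 ⟨(c, x), Finset.mem_univ _, rfl⟩)
    refine (Finset.card_le_card h).trans ((Finset.card_union_le _ _).trans ?_)
    have h₁ := Finset.card_image_le (s := (Finset.univ : Finset (Fin 3 × ι)))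
      (f := fun x => chain (s := s) x.1 0 i x.2)
    have h₂ := Finset.card_image_le (s := (Finset.univ : Finset (Fin 3 × ι)))
      (f := fun x => chain (s := s) x.1 (Fin.last _) x.2 i)
    simp only [Finset.card_univ, Fintype.card_prod, Fintype.card_fin] at h₁ h₂
    omega

end Degree

/-! ### Recovering the graph from its sparse graph -/

section Recover

variable [Fintype ι] {κ : Type*} [Fintype κ] {B : SimpleGraph κ}

open Classical in
/-- Hubs are the vertices of degree at least three. -/
theorem exists_map_hub (f : chainGraph s A ≃g chainGraph s B) (i : ι) :
    ∃ j, f (hub s i) = hub s j := by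
  by_contra! h
  have h₁ := card_adj_le_two (A := B) h
  have h₂ := three_le_card_adj_hub (s := s) (A := A) i
  have h₃ : (Finset.univ.filter ((chainGraph s A).Adj (hub s i))).card =
      (Finset.univ.filter ((chainGraph s B).Adj (f (hub s i)))).card :=
    Finset.card_equiv f.toEquiv fun x => by
      simp only [Finset.mem_filter, Finset.mem_univ, true_and, RelIso.coe_fn_toEquiv,
        f.map_adj_iff]
  omega

/-- An isomorphism of sparse graphs maps the chain between two adjacent vertices to a chain. -/
theorem adj_of_chainGraph_iso (f : chainGraph s A ≃g chainGraph s B) {g : ι → κ}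
    (hg : ∀ i, f (hub s i) = hub s (g i)) {i j : ι} (h : A.Adj i j) : B.Adj (g i) (g j) := by
  have hne : g i ≠ g j := fun e =>
    h.ne (hub_injective (f.injective (by rw [hg, hg, e])))
  -- No chain vertex is mapped to a hub.
  have not_hub (c : Fin 3) (q : Fin (2 * s + 1)) (k : κ) : f (chain c q i j) ≠ hub s k := by
    intro e
    obtain ⟨l, hl⟩ := exists_map_hub f.symm k
    have : chain c q i j = hub s l := by rw [← hl, ← e]; simp
    simp [chain, hub] at this
  have key (n : ℕ) : ∀ hn : n < 2 * s + 1, ∃ c q x y, f (chain 0 ⟨n, hn⟩ i j) = chain c q x y ∧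
      (x = g i ∨ y = g i ∧ B.Adj x y) := by
    induction n with
    | zero =>
      intro hn
      have h₁ : (chainGraph s A).Adj (hub s i) (chain 0 ⟨0, hn⟩ i j) :=
        hub_adj.2 ⟨rfl, 0, _, _, _, rfl, Or.inl ⟨rfl, rfl⟩⟩
      rw [← f.map_adj_iff, hg] at h₁
      obtain ⟨-, c, q, x, y, e, h₂⟩ := hub_adj.1 h₁
      exact ⟨c, q, x, y, e, h₂.imp (fun h => h.2) fun h => h.2⟩
    | succ n ih =>
      intro hn
      obtain ⟨c, q, x, y, e, hxy⟩ := ih (by omega)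
      have h₁ : (chainGraph s A).Adj (chain 0 ⟨n, by omega⟩ i j) (chain 0 ⟨n + 1, hn⟩ i j) :=
        chain_adj_chain.2 ⟨rfl, Or.inl rfl, rfl, rfl⟩
      rw [← f.map_adj_iff, e] at h₁
      generalize hw : f (chain 0 ⟨n + 1, hn⟩ i j) = w at h₁
      obtain ⟨(_ | ⟨c', q'⟩) | z, x', y'⟩ := w
      · obtain ⟨rfl, -⟩ := hub_adj.1 h₁.symm
        exact absurd hw (not_hub _ _ _)
      · obtain ⟨-, -, rfl, rfl⟩ := chain_adj_chain.1 h₁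
        exact ⟨c', q', x, y, rfl, hxy⟩
      · exact absurd h₁.symm not_pad_adj
  obtain ⟨c, q, x, y, e, hxy⟩ := key (2 * s) (by omega)
  have h₁ : (chainGraph s A).Adj (hub s j) (chain 0 ⟨2 * s, by omega⟩ i j) :=
    hub_adj.2 ⟨rfl, 0, _, _, _, rfl, Or.inr ⟨rfl, rfl, h⟩⟩
  rw [← f.map_adj_iff, hg, e] at h₁
  obtain ⟨-, c', q', x', y', e', h₂⟩ := hub_adj.1 h₁
  obtain ⟨-, rfl, rfl⟩ : (c = c' ∧ q = q') ∧ x = x' ∧ y = y' := by simpa [chain] using e'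
  rcases hxy with rfl | ⟨rfl, hB⟩ <;> rcases h₂ with ⟨-, e₂⟩ | ⟨-, e₂, hB'⟩
  · exact absurd e₂ hne
  · rwa [e₂] at hB'
  · rw [e₂] at hB
    exact hB.symm
  · exact absurd e₂ hne

theorem nonempty_iso_of_chainGraph_iso (f : chainGraph s A ≃g chainGraph s B) :
    Nonempty (A ≃g B) := by
  choose g hg using exists_map_hub f
  choose g' hg' using exists_map_hub f.symm
  have h₁ (i) : g' (g i) = i := hub_injective (s := s) (by rw [← hg', ← hg]; simp)
  have h₂ (i) : g (g' i) = i := hub_injective (s := s) (by rw [← hg, ← hg']; simp)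
  refine ⟨⟨⟨g, g', h₁, h₂⟩, fun {i j} => ⟨fun h => ?_, fun h => adj_of_chainGraph_iso f hg h⟩⟩⟩
  have := adj_of_chainGraph_iso f.symm hg' h
  simpa [h₁] using this

end Recover

/-! ### The dense graph, and its encoding -/

/-- An isomorphism of graphs extends to their sparse graphs twisted by classes. -/
theorem nonempty_twist_iso {κ : Type*} {B : SimpleGraph κ} {ℓ : Fin (s + 2) → Fin (s + 2) → Prop}
    (hℓ : ∀ k k', ℓ k k' ↔ ℓ k' k) (f : A ≃g B) :
    Nonempty ((chainGraph s A).twist (fun u => kindClass u.1) ℓ hℓ ≃g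
      (chainGraph s B).twist (fun u => kindClass u.1) ℓ hℓ) := by
  refine ⟨⟨(Equiv.refl _).prodCongr (f.toEquiv.prodCongr f.toEquiv), fun {u v} => ?_⟩⟩
  have hL (u v : Kind s × ι × ι) : Link B (u.1, f u.2.1, f u.2.2) (v.1, f v.2.1, f v.2.2) ↔
      Link A u v := by
    simp [Link, f.map_adj_iff]
  obtain ⟨a, i, j⟩ := u
  obtain ⟨b, i', j'⟩ := v
  have h₁ := hL (a, i, j) (b, i', j')
  have h₂ := hL (b, i', j') (a, i, j)
  simp only at h₁ h₂
  simp [SimpleGraph.twist, chainGraph, h₁, h₂]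

theorem sum_kindCount_injective (s n : ℕ) (hn : 0 < n) :
    Function.Injective fun X : Finset (Fin (s + 2)) => ∑ k ∈ X, kindCount s k * n := by
  intro X Y h
  have e (X : Finset (Fin (s + 2))) : ∑ k ∈ X, kindCount s k * n =
      (32 + Fintype.card (Core s)) * n * ∑ i ∈ X.map Fin.valEmbedding, 2 ^ i := by
    rw [Finset.sum_map, Finset.mul_sum]
    exact Finset.sum_congr rfl fun k _ => by simp [kindCount]; ring
  simp only [e] at h
  have := Nat.eq_of_mul_eq_mul_left (by positivity) h
  exact Finset.map_injective _ (Finset.geomSum_injective le_rfl this)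

theorem card_filter_kindClass_fst (ι : Type*) [Fintype ι] [DecidableEq ι] (k : Fin (s + 2)) :
    (Finset.univ.filter fun u : Kind s × ι × ι => kindClass u.1 = k).card =
      kindCount s k * (Fintype.card ι * Fintype.card ι) := by
  have : (Finset.univ.filter fun u : Kind s × ι × ι => kindClass u.1 = k) =
      (Finset.univ.filter fun a : Kind s => kindClass a = k) ×ˢ Finset.univ := by
    ext ⟨a, i, j⟩
    simp only [Finset.mem_filter, Finset.mem_univ, true_and, Finset.mem_product, and_true]
  rw [this, Finset.card_product, card_filter_kindClass, Finset.card_univ, Fintype.card_prod]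

/-- A graph can be recovered from its sparse graph twisted by classes. -/
theorem nonempty_iso_of_twist_iso [Fintype ι] {κ : Type*} [Fintype κ] {B : SimpleGraph κ}
    {ℓ : Fin (s + 2) → Fin (s + 2) → Prop} {hℓ : ∀ k k', ℓ k k' ↔ ℓ k' k}
    (f : (chainGraph s A).twist (fun u => kindClass u.1) ℓ hℓ ≃g
      (chainGraph s B).twist (fun u => kindClass u.1) ℓ hℓ) : Nonempty (A ≃g B) := by
  classical
  have hcard : Fintype.card ι = Fintype.card κ := by
    have := Fintype.card_congr f.toEquiv
    simp only [Fintype.card_prod] at this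
    have hpos : 0 < Fintype.card (Kind s) := Fintype.card_pos_iff.2 ⟨.inl none⟩
    exact Nat.mul_self_inj.1 (Nat.eq_of_mul_eq_mul_left hpos this)
  rcases isEmpty_or_nonempty ι with hι | hι
  · have : IsEmpty κ := Fintype.card_eq_zero_iff.1 (hcard ▸ Fintype.card_eq_zero)
    exact ⟨⟨Equiv.equivOfIsEmpty _ _, fun {i} => isEmptyElim i⟩⟩
  · have hκ : Nonempty κ := Fintype.card_pos_iff.1 (hcard ▸ Fintype.card_pos)
    have hpos : 0 < Fintype.card ι := Fintype.card_pos
    have h := SimpleGraph.adj_iff_of_twist_iso (d := 6 * Fintype.card ι)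
      (w := fun k => kindCount s k * (Fintype.card ι * Fintype.card ι))
      (fun u => card_adj_le u) (fun u => hcard ▸ card_adj_le u)
      (fun k => by convert card_filter_kindClass_fst ι k)
      (fun k => by rw [hcard]; convert card_filter_kindClass_fst κ k)
      (fun k => by
        -- `32 n² > 4 · 6 n + 4`
        have h₁ : 32 ≤ kindCount s k :=
          (Nat.le_add_right _ _).trans (Nat.le_mul_of_pos_right _ (by positivity))
        have h₂ : Fintype.card ι ≤ Fintype.card ι * Fintype.card ι :=
          Nat.le_mul_of_pos_right _ hpos
        have h₃ := Nat.mul_le_mul h₁ h₂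
        omega)
      (sum_kindCount_injective s _ (Nat.mul_pos hpos hpos)) f
    exact nonempty_iso_of_chainGraph_iso ⟨f.toEquiv, fun {u v} => h u v⟩

end ChainGraph

namespace ChainGraph

variable {s : ℕ} {ι : Type*} {A : SimpleGraph ι}

/-- Adjacent vertices of the sparse graph have consecutive classes. -/
theorem succ_class_of_adj {u v : Kind s × ι × ι} (h : (chainGraph s A).Adj u v) :
    (kindClass u.1 : ℕ) + 1 = kindClass v.1 ∨ (kindClass v.1 : ℕ) + 1 = kindClass u.1 := by
  have hub_chain {i j : ι} {w : Kind s × ι × ι} (h : (chainGraph s A).Adj (.inl none, i, j) w) :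
      (kindClass w.1 : ℕ) = 1 := by
    obtain ⟨-, c, q, x, y, rfl, h⟩ := hub_adj.1 h
    simp only [chain, kindClass, coreClass]
    omega
  obtain ⟨(_ | ⟨c, q⟩) | z, i, j⟩ := u
  · left
    rw [hub_chain h]
    rfl
  · obtain ⟨(_ | ⟨c', q'⟩) | z, i', j'⟩ := v
    · right
      rw [hub_chain h.symm]
      rfl
    · obtain ⟨rfl, hq, rfl, rfl⟩ := chain_adj_chain.1 h
      simp only [kindClass, coreClass]
      omega
    · exact absurd h.symm not_pad_adj
  · exact absurd h not_pad_adj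

theorem class_prev (c : Fin 3) (q : Fin (2 * s + 1)) (i j : ι) :
    (kindClass (prev c q i j).1 : ℕ) = min (q : ℕ) (2 * s + 2 - q) := by
  unfold prev
  split_ifs with h
  · simp [hub, kindClass, coreClass, h]
  · simp only [chain, kindClass, coreClass]
    omega

theorem class_next (c : Fin 3) (q : Fin (2 * s + 1)) (i j : ι) :
    (kindClass (next c q i j).1 : ℕ) = min (q + 2 : ℕ) (2 * s - q) := by
  unfold next
  split_ifs with h
  · simp [hub, kindClass, coreClass, h]
  · simp only [chain, kindClass, coreClass]
    omega

/-- For a simple path encoding, the sparse graph twisted by the labels along the path lies in the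
encoded class: a hub has neighbors in class `1` only, the middle of a chain has up to two neighbors
in the class before the last one, and each other vertex has at most one neighbor in each class. -/
theorem encodes_twist {J : Type*} (E : GraphEncoding J) (p : Fin (s + 2) → J)
    (hp : Function.Injective p) (h₀ : E.LN (p 0) (p 1) = ⊤)
    (h₁ : 2 ≤ E.LN (p (Fin.last s).succ) (p (Fin.last s).castSucc))
    (h₂ : ∀ k : Fin (s + 1),
      1 ≤ E.LN (p k.castSucc) (p k.succ) ∧ 1 ≤ E.LN (p k.succ) (p k.castSucc))
    (hℓ : ∀ k k', E.L (p k) (p k') = .A ↔ E.L (p k') (p k) = .A) :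
    E.Encodes ((chainGraph s A).twist (fun u => kindClass u.1)
      (fun k k' => E.L (p k) (p k') = .A) hℓ) := by
  refine ⟨fun u => p (kindClass u.1), fun u j => ?_⟩
  -- In both cases the exceptions are the neighbors in the sparse graph.
  suffices h : E.LN (p (kindClass u.1)) j ≠ ⊤ →
      {v | (chainGraph s A).Adj u v ∧ p (kindClass v.1) = j}.encard ≤
        E.LN (p (kindClass u.1)) j by
    constructor
    · intro hL hN
      refine (Set.encard_le_encard ?_).trans (h hN)
      rintro v ⟨hne, hv, rfl⟩
      refine ⟨?_, rfl⟩
      by_contra hS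
      exact hv ⟨hne.symm, by simp [hL, hS]⟩
    · intro hL hN
      refine (Set.encard_le_encard ?_).trans (h hN)
      rintro v ⟨hne, hv, rfl⟩
      refine ⟨?_, rfl⟩
      by_contra hS
      have := hv.2.2 hS
      simp only [hL, reduceCtorEq] at this
  intro hN
  rcases Set.eq_empty_or_nonempty {v | (chainGraph s A).Adj u v ∧ p (kindClass v.1) = j} with h | h
  · simp [h]
  obtain ⟨v, hv, rfl⟩ := h
  have hone : 1 ≤ E.LN (p (kindClass u.1)) (p (kindClass v.1)) := by
    rcases succ_class_of_adj hv with h | h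
    · have hlt := (kindClass v.1).2
      have := (h₂ ⟨kindClass u.1, by omega⟩).1
      rwa [show Fin.castSucc ⟨kindClass u.1, _⟩ = kindClass u.1 from rfl,
        show Fin.succ ⟨kindClass u.1, _⟩ = kindClass v.1 from Fin.ext h] at this
    · have hlt := (kindClass u.1).2
      have := (h₂ ⟨kindClass v.1, by omega⟩).2
      rwa [show Fin.castSucc ⟨kindClass v.1, _⟩ = kindClass v.1 from rfl,
        show Fin.succ ⟨kindClass v.1, _⟩ = kindClass u.1 from Fin.ext h] at this
  obtain ⟨(_ | ⟨c, q⟩) | z, i, j⟩ := u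
  · -- At a hub there is no bound to be respected.
    have hv' : kindClass v.1 = 1 := by
      rcases succ_class_of_adj hv with h | h
      · exact Fin.ext (by simpa [kindClass, coreClass] using h.symm)
      · simp [kindClass, coreClass] at h
    exact absurd (by rw [hv']; exact h₀) hN
  · have hsub : {w | (chainGraph s A).Adj (chain c q i j) w ∧
        p (kindClass w.1) = p (kindClass v.1)} ⊆ {prev c q i j, next c q i j} :=
      fun w hw => eq_prev_or_eq_next hw.1
    by_cases hq : (q : ℕ) = s
    · refine ((Set.encard_le_encard hsub).trans (Set.encard_insert_le _ _)).trans ?_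
      rw [Set.encard_singleton, one_add_one_eq_two]
      have hu : kindClass (Sum.inl (some (c, q)) : Kind s) = (Fin.last s).succ :=
        Fin.ext (by simp [kindClass, coreClass]; omega)
      have hv' : kindClass v.1 = (Fin.last s).castSucc := by
        refine Fin.ext ?_
        rcases eq_prev_or_eq_next hv with rfl | rfl
        · simp [class_prev]; omega
        · simp [class_next]; omega
      rw [hv']
      change _ ≤ E.LN (p (kindClass (Sum.inl (some (c, q)) : Kind s))) _
      rw [hu]
      exact h₁
    · refine le_trans ?_ hone
      refine Set.encard_le_one_iff.2 fun w w' hw hw' => ?_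
      have hcl : (kindClass w.1 : ℕ) = kindClass w'.1 :=
        congrArg Fin.val (hp (hw.2.trans hw'.2.symm))
      have hq' := q.2
      rcases hsub hw with rfl | rfl <;> rcases hsub hw' with rfl | rfl
      · rfl
      · rw [class_prev, class_next] at hcl
        omega
      · rw [class_prev, class_next] at hcl
        omega
      · rfl
  · exact absurd hv not_pad_adj

end ChainGraph

/-! ### The dense graph as a machine output -/

theorem List.finRange_mul (m n : ℕ) : List.finRange (m * n) =
    (List.finRange m).flatMap fun i => (List.finRange n).map fun j => finProdFinEquiv (i, j) := by
  rw [← List.ofFn_id, List.ofFn_mul, List.flatMap_def, List.ofFn_eq_map]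
  congr 2
  funext i
  rw [List.ofFn_eq_map]
  refine List.map_congr_left fun j _ => Fin.ext ?_
  simp [finProdFinEquiv]
  ring

namespace FinGraph

open Classical in
/-- The entries of the adjacency matrix, row by row. -/
noncomputable def matrixWord (G : FinGraph) : List Bool :=
  (List.finRange G.order).flatMap fun i =>
    (List.finRange G.order).map fun j => decide (G.graph.Adj i j)

open Classical in
theorem matrixWord_eq (G : FinGraph) : G.matrixWord = List.ofFn fun x : Fin (G.order * G.order) =>
    decide (G.graph.Adj (finProdFinEquiv.symm x).1 (finProdFinEquiv.symm x).2) := by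
  rw [List.ofFn_eq_map, List.finRange_mul, List.map_flatMap]
  simp only [matrixWord, List.map_map, Function.comp_def, Equiv.symm_apply_apply]

theorem length_matrixWord (G : FinGraph) : G.matrixWord.length = G.order * G.order := by
  simp [matrixWord_eq]

open Classical in
theorem getD_matrixWord (G : FinGraph) (i j : Fin G.order) :
    G.matrixWord.getD (i * G.order + j) false = decide (G.graph.Adj i j) := by
  have h : (i : ℕ) * G.order + j = (finProdFinEquiv (i, j) : ℕ) := by
    simp [finProdFinEquiv]
    ring
  rw [h, matrixWord_eq, List.getD_eq_getElem _ _ (by simp only [List.length_ofFn, Fin.is_lt]),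
    List.getElem_ofFn]
  simp only [Fin.eta, Equiv.symm_apply_apply]

/-- The graph on `{0, …, T * (n * n) - 1}` corresponding to a graph on the triples of one of `T`
kinds and two vertices. -/
noncomputable def ofTriples {K : Type*} [Fintype K] (n : ℕ) (D : SimpleGraph (K × Fin n × Fin n)) :
    FinGraph where
  order := Fintype.card K * (n * n)
  graph := D.comap fun x => ((Fintype.equivFin K).symm (finProdFinEquiv.symm x).1,
    finProdFinEquiv.symm (finProdFinEquiv.symm x).2)

/-- The numbering of triples is an isomorphism. -/
noncomputable def ofTriplesIso {K : Type*} [Fintype K] (n : ℕ)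
    (D : SimpleGraph (K × Fin n × Fin n)) : (ofTriples n D).graph ≃g D where
  toEquiv := finProdFinEquiv.symm.trans
    ((Fintype.equivFin K).symm.prodCongr finProdFinEquiv.symm)
  map_rel_iff' := Iff.rfl

/-- All kinds, in the order of their numbers. -/
noncomputable def kinds (K : Type*) [Fintype K] : List K :=
  (List.finRange (Fintype.card K)).map (Fintype.equivFin K).symm

theorem encode_ofTriples {K : Type} [Fintype K] (G : FinGraph)
    (D : SimpleGraph (K × Fin G.order × Fin G.order)) (f : GraphMem.EntryRule K)
    (hf : ∀ u v, f u.1 v.1 (decide (u.2.1 = v.2.1)) (decide (u.2.2 = v.2.2))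
      (decide (u.2.1 = u.2.2)) (decide (v.2.1 = v.2.2))
      (G.matrixWord.getD (u.2.1 * G.order + u.2.2) false)
      (G.matrixWord.getD (v.2.1 * G.order + v.2.2) false) = true ↔ D.Adj u v) :
    (ofTriples G.order D).encode = GraphMem.ruleWord (kinds K) f G.order G.matrixWord := by
  classical
  have hflat (g : Fin (Fintype.card K * (G.order * G.order)) → List Bool)
      (h : K → ℕ → ℕ → List Bool)
      (e : ∀ a (i j : Fin G.order), g (finProdFinEquiv (Fintype.equivFin K a,
        finProdFinEquiv (i, j))) = h a i j) :
      (List.finRange _).flatMap g = (kinds K).flatMap fun a => (List.range G.order).flatMap fun i =>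
        (List.range G.order).flatMap fun j => h a i j := by
    rw [List.finRange_mul, List.finRange_mul]
    simp only [kinds, List.flatMap_assoc, List.flatMap_map, List.map_flatMap, List.map_map,
      Function.comp_def, ← List.map_coe_finRange_eq_range, ← e, Equiv.apply_symm_apply]
  have h₁ : List.replicate (Fintype.card K * (G.order * G.order)) true =
      (kinds K).flatMap fun _ => (List.range G.order).flatMap fun _ =>
        (List.range G.order).flatMap fun _ => [true] := by
    rw [← hflat (fun _ => [true]) _ fun _ _ _ => rfl]
    refine (List.eq_replicate_iff.2 ⟨by simp, by simp⟩).symm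
  unfold encode GraphMem.ruleWord
  rw [List.append_assoc, List.singleton_append, ← h₁]
  congr 2
  refine hflat _ _ fun a i j => ?_
  rw [List.map_eq_flatMap]
  refine hflat _ _ fun a' i' j' => ?_
  refine congrArg (fun b => [b]) ?_
  rw [Bool.eq_iff_iff, decide_eq_true_iff]
  have := hf (a, i, j) (a', i', j')
  simp only [Fin.ext_iff] at this
  rw [this]
  simp only [ofTriples, SimpleGraph.comap_adj, Equiv.symm_apply_apply]

end FinGraph

/-! ### Graph isomorphism completeness -/

theorem GraphEncoding.Encodes.of_iso {J : Type*} {E : GraphEncoding J} {V W : Type*}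
    {G : SimpleGraph V} {H : SimpleGraph W} (h : E.Encodes H) (f : G ≃g H) : E.Encodes G := by
  obtain ⟨φ, hφ⟩ := h
  refine ⟨φ ∘ f, fun v j => ?_⟩
  have hA := (hφ (f v) j).1
  have hN := (hφ (f v) j).2
  constructor
  · intro hL hT
    refine le_trans ?_ (hA hL hT)
    rw [← f.injective.encard_image]
    refine Set.encard_le_encard ?_
    rintro _ ⟨w, ⟨h₁, h₂, h₃⟩, rfl⟩
    exact ⟨f.injective.ne h₁, by rwa [f.map_adj_iff], h₃⟩
  · intro hL hT
    refine le_trans ?_ (hN hL hT)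
    rw [← f.injective.encard_image]
    refine Set.encard_le_encard ?_
    rintro _ ⟨w, ⟨h₁, h₂, h₃⟩, rfl⟩
    exact ⟨f.injective.ne h₁, by rwa [f.map_adj_iff], h₃⟩

namespace ChainGraph

open Classical in
/-- The adjacency rule of the twisted sparse graph. -/
noncomputable def entryRule (s : ℕ) (ℓ : Fin (s + 2) → Fin (s + 2) → Prop) :
    GraphMem.EntryRule (Kind s) := fun a a' e₁ e₂ e₃ e₄ x x' =>
  decide (¬(a = a' ∧ e₁ ∧ e₂) ∧ (ℓ (kindClass a) (kindClass a') ↔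
    ¬(linkRule a a' e₁ e₂ e₃ e₄ x ∨ linkRule a' a e₁ e₂ e₄ e₃ x')))

theorem entryRule_iff {s : ℕ} {ℓ : Fin (s + 2) → Fin (s + 2) → Prop}
    (hℓ : ∀ k k', ℓ k k' ↔ ℓ k' k) (G : FinGraph) (u v : Kind s × Fin G.order × Fin G.order) :
    entryRule s ℓ u.1 v.1 (decide (u.2.1 = v.2.1)) (decide (u.2.2 = v.2.2))
      (decide (u.2.1 = u.2.2)) (decide (v.2.1 = v.2.2))
      (G.matrixWord.getD (u.2.1 * G.order + u.2.2) false)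
      (G.matrixWord.getD (v.2.1 * G.order + v.2.2) false) = true ↔
      ((chainGraph s G.graph).twist (fun u => kindClass u.1) ℓ hℓ).Adj u v := by
  obtain ⟨a, i, j⟩ := u
  obtain ⟨a', i', j'⟩ := v
  simp only [entryRule, FinGraph.getD_matrixWord, decide_eq_true_eq, SimpleGraph.twist, chainGraph,
    SimpleGraph.fromRel_adj, Link, ne_eq, Prod.mk.injEq, eq_comm (a := i') (b := i),
    eq_comm (a := j') (b := j)]
  tauto

/-- The dense graph of a graph. -/
noncomputable def denseGraph {s : ℕ} {ℓ : Fin (s + 2) → Fin (s + 2) → Prop}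
    (hℓ : ∀ k k', ℓ k k' ↔ ℓ k' k) (G : FinGraph) : FinGraph :=
  .ofTriples G.order ((chainGraph s G.graph).twist (fun u => kindClass u.1) ℓ hℓ)

theorem nonempty_denseGraph_iso {s : ℕ} {ℓ : Fin (s + 2) → Fin (s + 2) → Prop}
    (hℓ : ∀ k k', ℓ k k' ↔ ℓ k' k) (G H : FinGraph) :
    Nonempty ((denseGraph hℓ G).graph ≃g (denseGraph hℓ H).graph) ↔
      Nonempty (G.graph ≃g H.graph) := by
  constructor
  · rintro ⟨f⟩
    exact nonempty_iso_of_twist_iso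
      ((FinGraph.ofTriplesIso _ _).symm.trans (f.trans (FinGraph.ofTriplesIso _ _)))
  · rintro ⟨f⟩
    obtain ⟨g⟩ := nonempty_twist_iso hℓ f
    exact ⟨(FinGraph.ofTriplesIso _ _).trans (g.trans (FinGraph.ofTriplesIso _ _).symm)⟩

end ChainGraph

open ChainGraph in
theorem mainTheorem4 {J : Type*} [Finite J] (E : GraphEncoding J) (hE : E.IsSimplePath) :
    IsGraphIsomorphismComplete E.encodedClass := by
  obtain ⟨hL, s, p, hp, h₀, h₁, h₂⟩ := hE
  have hℓ (k k' : Fin (s + 2)) : E.L (p k) (p k') = .A ↔ E.L (p k') (p k) = .A := by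
    rw [hL]
  have hmem (G : FinGraph) : denseGraph hℓ G ∈ E.encodedClass :=
    (encodes_twist E p hp h₀ h₁ h₂ hℓ).of_iso (FinGraph.ofTriplesIso _ _)
  refine ⟨⟨id, ⟨Turing.idComputableInPolyTime _⟩, fun x hx => ⟨trivial, trivial, hx.2.2⟩,
    fun x hx => ⟨trivial, trivial, hx.2.2⟩⟩,
    fun x => (denseGraph hℓ x.1, denseGraph hℓ x.2), ?_, fun x hx => ⟨hmem _, hmem _, ?_⟩,
    fun x hx => ⟨hmem _, hmem _, ?_⟩⟩
  · exact GraphMem.polyTime_of_entryRule (FinGraph.kinds (Kind s)) (entryRule s _) (denseGraph hℓ)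
      FinGraph.matrixWord FinGraph.length_matrixWord (fun _ => rfl)
      fun G => FinGraph.encode_ofTriples G _ _ (entryRule_iff hℓ G)
  · exact (nonempty_denseGraph_iso hℓ _ _).2 hx.2.2
  · rw [nonempty_denseGraph_iso]
    exact hx.2.2
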